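/- **Setting.** For every $n$ let $\mathcal Y_n\subseteq\mathbb R$ be an interval, $\mathcal X_n=\mathbb R^{p_n}$, $\mathcal Z_n=\mathcal Y_n\times\mathcal X_n$, and let $t_i=(y_i,x_i)$, $1\le i\le n+1$, be i.i.d. with law a Borel probability measure $P_n$ on $\mathcal Z_n$ (everything may depend on $n$). Put $T_n=(t_1,\dots,t_n)$ and let $T_n^{\setminus i}$ be $T_n$ without $t_i$. A family of conformity scores $\mathfrak C$ consists of measurable $\mathcal C_m=\mathcal C^{(n)}_m:\mathcal Z_n\times\mathcal Z_n^m\to\mathbb R$, symmetric in the $m$ data points; it is *stable* if $|\mathcal C_n(t_{n+1},T_n)-\mathcal C_{n-1}(t_{n+1},T_n^{\setminus n})|\to0$ in probability. A symmetric prediction algorithm $\mathcal A$ consists of measurable $\mathcal A_m=\mathcal A_{n,m}:\mathcal X_n\times\mathcal Z_n^m\to\mathcal Y_n$, symmetric in the data; it is *asymptotically out-of-sample stable* if $\mathcal A_n(x_{n+1},T_n)-\mathcal A_{n-1}(x_{n+1},T_n^{\setminus n})\to0$ in probability. Its out-of-sample score is $\mathcal C^{out}_m((y,x),T)=|y-\mathcal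 A_m(x,T)|$. For $F:\mathbb R\to[0,1]$ let $Q_\alpha(F)=\inf\{s\in\mathbb R:F(s)\ge\alpha\}\in[-\infty,\infty]$ with $\inf\emptyset=+\infty$. Write $x=x_{n+1}$, let $\hat u_i=y_i-\mathcal A_{n-1}(x_i,T_n^{\setminus i})$, let $\hat G$ be the empirical distribution function of $\mathcal C_{n-1}(t_i,T_n^{\setminus i})$, $1\le i\le n$, and, for $y\in\mathcal Y_n$ and $D^y=(t_1,\dots,t_n,(y,x))$, let $$\hat F_y(s)=\tfrac1{n+1}\Big(\mathbf 1\{\mathcal C_n((y,x),T_n)\le s\}+\sum_{i=1}^n\mathbf 1\{\mathcal C_n(t_i,D^y\setminus t_i)\le s\}\Big).$$ For $\alpha\in[0,1]$, $\delta\ge0$ define the following subsets of $\mathcal Y_n$: * full conformal: $PS^{fc}_\alpha(\delta)=\{y:\mathcal C_n((y,x),T_n)\le Q_{1-\alpha}(\hat F_y)+\delta\}$; * shortcut: $PS^{sc}_\alpha(\delta)=\{y:\mathcal C_n((y,x),T_n)\le Q_{1-\alpha}(\hat G)+\delta\}$; * $n$-fold cross-conformal: $PS^{cc}_\alpha(\delta)=\{y:1+\sum_{i=1}^n\mathbf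 1\{\mathcal C_{n-1}((y,x),T_n^{\setminus i})\le\mathcal C_{n-1}(t_i,T_n^{\setminus i})+\delta\}>\alpha(n+1)\}$; * symmetric Jackknife: $PI^{sJ}_\alpha(\delta)=\{y:\mathcal A_n(x,T_n)-(q+\delta)\le y\le\mathcal A_n(x,T_n)+(q+\delta)\}$, where $q$ is the $(1-\alpha)$-quantile of the empirical distribution of $|\hat u_i|$, $1\le i\le n$; * symmetric Jackknife+: $PI^{sJ+}_\alpha(\delta)=\{y:q^--\delta\le y\le q^++\delta\}$, where $q^-$ is the $\alpha$-quantile of the empirical distribution of $\mathcal A_{n-1}(x,T_n^{\setminus i})-|\hat u_i|$ and $q^+$ the $(1-\alpha)$-quantile of that of $\mathcal A_{n-1}(x,T_n^{\setminus i})+|\hat u_i|$, $1\le i\le n$; * oracle: $PI^{or}_\alpha(\delta)=\{y:|y-\mathcal A_n(x,T_n)|<Q_{1-\alpha}(H)+\delta\}$ with $H(s)=P(|y_{n+1}-\mathcal A_n(x_{n+1},T_n)|\le s\mid T_n)$. A method $PS$ is *(inflated) asymptotically uniformly conditionally conservative* if, for all $\delta,\epsilon>0$, $P\big(\sup_{\alpha\in[0,1]}(P(y_{n+1}\notin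 PS_\alpha(\delta)\mid T_n)-\alpha)\ge\epsilon\big)\to0$, and *(non-inflated) asymptotically uniformly conditionally valid* if $E\sup_{\alpha\in[0,1]}|P(y_{n+1}\notin PS_\alpha(0)\mid T_n)-\alpha|\to0$. Assumption CC for $\mathfrak C$: for every $n\ge1$ and almost every $T_n$, the conditional law of $\mathcal C_n(t_{n+1},T_n)$ given $T_n$ has a Lebesgue density $f_{T_n}$, and $(\|f_{T_n}\|_\infty)_{n\ge1}$ is stochastically bounded. Write $PS^1\leftrightharpoons PS^2$ (with respect to $\mathfrak C$) if $PS^1$ is inflated conservative iff $PS^2$ is and, whenever CC holds for $\mathfrak C$, $PS^1$ is non-inflated valid iff $PS^2$ is. **Statement.** (a) If $\mathfrak C$ is stable, then $PS^{fc}$, $PS^{sc}$ and $PS^{cc}$ are mutually equivalent: $PS^{fc}\leftrightharpoons PS^{sc}\leftrightharpoons PS^{cc}$, and $PS^{fc}\leftrightharpoons PS^{cc}$. (b) For every symmetric, asymptotically out-of-sample stable algorithm $\mathcal A$, $PI^{sJ}\leftrightharpoons PI^{sJ+}$ (with respect to $\mathcal C^{out}$). (c) Let the score be $\mathcal C^{out}$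 for a symmetric algorithm $\mathcal A$. (i) $PI^{sJ}_\alpha(\delta)=PS^{sc}_\alpha(\delta)$ for all $n$, all real $\alpha,\delta$, all training data and all $x$. (ii) If $\mathcal A$ is asymptotically out-of-sample stable, then $PS^{fc}\leftrightharpoons PS^{cc}\leftrightharpoons PS^{sc}=PI^{sJ}\leftrightharpoons PI^{sJ+}$. (iii) If, additionally, $(y_{n+1}-\mathcal A_n(x_{n+1},T_n))_{n\ge1}$ is bounded in probability, then $PS^{fc}$, $PS^{cc}$, $PI^{sJ}$ and $PI^{sJ+}$ are all inflated asymptotically uniformly conditionally conservative and, under CC for $\mathcal C^{out}$, non-inflated asymptotically uniformly conditionally valid; in particular, each of them is $\leftrightharpoons$-equivalent to $PI^{or}$. -/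

import Mathlib

open Set Filter Topology MeasureTheory

noncomputable section

namespace Conformal

/-- A response-feature pair `(y, x)` with response in `Y ⊆ ℝ` and feature vector in `ℝ^p`. -/
abbrev Obs (Y : Set ℝ) (p : ℕ) : Type := ↥Y × EuclideanSpace ℝ (Fin p)

/-- A family of scores: `C n m z T` is the score of the pair `z` with respect to a data set `T`
of size `m`, in the `n`-th model. -/
abbrev Score (Y : ℕ → Set ℝ) (p : ℕ → ℕ) : Type :=
  ∀ n m : ℕ, Obs (Y n) (p n) → (Fin m → Obs (Y n) (p n)) → ℝ

/-- Every member of a family of conformity scores is measurable, and symmetric in the data. -/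
structure IsConformityScore {Y : ℕ → Set ℝ} {p : ℕ → ℕ} (C : Score Y p) : Prop where
  measurable : ∀ n m : ℕ, Measurable
    (fun w : Obs (Y n) (p n) × (Fin m → Obs (Y n) (p n)) => C n m w.1 w.2)
  symmetric : ∀ (n m : ℕ) (z : Obs (Y n) (p n)) (T : Fin m → Obs (Y n) (p n))
    (π : Equiv.Perm (Fin m)), C n m z (fun j => T (π j)) = C n m z T

/-- A family of prediction algorithms: `A n m x T` is the prediction at the feature vector `x`
after training on the data set `T` of size `m`, in the `n`-th model. -/
abbrev Algorithm (Y : ℕ → Set ℝ) (p : ℕ → ℕ) : Type :=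
  ∀ n m : ℕ, EuclideanSpace ℝ (Fin (p n)) → (Fin m → Obs (Y n) (p n)) → ↥(Y n)

/-- Every member of the family of prediction algorithms is measurable, and symmetric in the
training data. -/
structure IsSymmetricAlgorithm {Y : ℕ → Set ℝ} {p : ℕ → ℕ} (A : Algorithm Y p) : Prop where
  measurable : ∀ n m : ℕ, Measurable
    (fun w : EuclideanSpace ℝ (Fin (p n)) × (Fin m → Obs (Y n) (p n)) => A n m w.1 w.2)
  symmetric : ∀ (n m : ℕ) (x : EuclideanSpace ℝ (Fin (p n))) (T : Fin m → Obs (Y n) (p n))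
    (π : Equiv.Perm (Fin m)), A n m x (fun j => T (π j)) = A n m x T

/-- The absolute out-of-sample prediction error of an algorithm, as a score. -/
def outScore {Y : ℕ → Set ℝ} {p : ℕ → ℕ} (A : Algorithm Y p) : Score Y p :=
  fun n m z T => |(z.1 : ℝ) - (A n m z.2 T : ℝ)|

/-- The data set `T` without its `i`-th entry. -/
def del {Z : Type*} : {n : ℕ} → (Fin n → Z) → Fin n → (Fin (n - 1) → Z)
  | _ + 1, T, i => i.removeNth T
  | 0, _, i => i.elim0

/-- The `α`-quantile `inf {s | α ≤ F s}` in `[-∞, ∞]`, where `inf ∅ = ∞`. -/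
def quantile (α : ℝ) (F : ℝ → ℝ) : EReal := sInf ((fun s : ℝ => (s : EReal)) '' {s | α ≤ F s})

/-- The empirical distribution function of `v 0, …, v (n - 1)`. -/
def ecdf {n : ℕ} (v : Fin n → ℝ) (s : ℝ) : ℝ := (∑ i, if v i ≤ s then (1 : ℝ) else 0) / n

/-! ### Prediction sets -/

/-- A method of constructing prediction sets: `M n α δ T x` is the `δ`-distorted prediction set
with nominal coverage `1 - α`, for training data `T` of size `n` and new feature vector `x`. -/
abbrev Method (Y : ℕ → Set ℝ) (p : ℕ → ℕ) : Type :=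
  ∀ n : ℕ, ℝ → ℝ → (Fin n → Obs (Y n) (p n)) → EuclideanSpace ℝ (Fin (p n)) → Set ↥(Y n)

section Sets

variable {Y : ℕ → Set ℝ} {p : ℕ → ℕ}

/-- The empirical distribution function of all the scores in the data set `T` augmented by `z`. -/
def augmentedCdf (C : Score Y p) (n : ℕ) (T : Fin n → Obs (Y n) (p n)) (z : Obs (Y n) (p n))
    (s : ℝ) : ℝ :=
  (if C n n z T ≤ s then (1 : ℝ) else 0) / (n + 1) +
    (1 / (n + 1)) * ∑ i : Fin n,
      if C n n (T i) (i.castSucc.removeNth (Fin.snoc T z : Fin (n + 1) → Obs (Y n) (p n))) ≤ s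
        then (1 : ℝ) else 0

/-- Full conformal prediction sets. -/
def fullConformal (C : Score Y p) : Method Y p := fun n α δ T x =>
  {y | (C n n (y, x) T : EReal) ≤ quantile (1 - α) (augmentedCdf C n T (y, x)) + (δ : EReal)}

/-- Shortcut prediction sets: the quantile is that of the leave-one-out scores. -/
def shortcut (C : Score Y p) : Method Y p := fun n α δ T x =>
  {y | (C n n (y, x) T : EReal) ≤
    quantile (1 - α) (ecdf fun i : Fin n => C n (n - 1) (T i) (del T i)) + (δ : EReal)}

/-- `n`-fold cross-conformal prediction sets. -/
def crossConformal (C : Score Y p) : Method Y p := fun n α δ T x =>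
  {y | α * (n + 1) < 1 + ∑ i : Fin n,
    if C n (n - 1) (y, x) (del T i) ≤ C n (n - 1) (T i) (del T i) + δ then (1 : ℝ) else 0}

/-- The absolute leave-one-out residuals of an algorithm. -/
def looResidual (A : Algorithm Y p) (n : ℕ) (T : Fin n → Obs (Y n) (p n)) (i : Fin n) : ℝ :=
  |((T i).1 : ℝ) - (A n (n - 1) (T i).2 (del T i) : ℝ)|

/-- The symmetric Jackknife: the prediction plus and minus the (inflated) quantile of the
absolute leave-one-out residuals. -/
def jackknife (A : Algorithm Y p) : Method Y p := fun n α δ T x =>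
  {y | (A n n x T : EReal) - (quantile (1 - α) (ecdf (looResidual A n T)) + (δ : EReal))
        ≤ ((y : ℝ) : EReal) ∧
      ((y : ℝ) : EReal) ≤
        (A n n x T : EReal) + (quantile (1 - α) (ecdf (looResidual A n T)) + (δ : EReal))}

/-- The symmetric Jackknife+: from the `α`-quantile of the leave-one-out predictions minus the
absolute leave-one-out residuals to the `(1 - α)`-quantile of the leave-one-out predictions plus
the absolute leave-one-out residuals, inflated by `δ` at both ends. -/
def jackknifePlus (A : Algorithm Y p) : Method Y p := fun n α δ T x =>
  {y | quantile α (ecdf fun i : Fin n => (A n (n - 1) x (del T i) : ℝ) - looResidual A n T i)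
        - (δ : EReal) ≤ ((y : ℝ) : EReal) ∧
      ((y : ℝ) : EReal) ≤
        quantile (1 - α)
          (ecdf fun i : Fin n => (A n (n - 1) x (del T i) : ℝ) + looResidual A n T i)
        + (δ : EReal)}

/-- The oracle prediction interval (an open interval): it uses the quantile of the true
distribution of the absolute prediction error given the training data. -/
def oracle (P : ∀ n, Measure (Obs (Y n) (p n))) (A : Algorithm Y p) : Method Y p :=
  fun n α δ T x =>
  {y | (A n n x T : EReal) -
        (quantile (1 - α) (fun s => (P n).real {z | outScore A n n z T ≤ s}) + (δ : EReal))
        < ((y : ℝ) : EReal) ∧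
      ((y : ℝ) : EReal) < (A n n x T : EReal) +
        (quantile (1 - α) (fun s => (P n).real {z | outScore A n n z T ≤ s}) + (δ : EReal))}

end Sets

/-! ### Asymptotic properties

In the `n`-th model the training data are i.i.d. with law `P n`, and the new pair is independent
of them, with the same law. -/

section Asymptotics

variable {Y : ℕ → Set ℝ} {p : ℕ → ℕ}

/-- The law of `n` i.i.d. training pairs. -/
abbrev trainLaw (P : ∀ n, Measure (Obs (Y n) (p n))) (n : ℕ) :
    Measure (Fin n → Obs (Y n) (p n)) := Measure.pi fun _ => P n

/-- The joint law of `n` i.i.d. training pairs and the new pair. -/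
abbrev jointLaw (P : ∀ n, Measure (Obs (Y n) (p n))) (n : ℕ) :
    Measure ((Fin n → Obs (Y n) (p n)) × Obs (Y n) (p n)) := (trainLaw P n).prod (P n)

/-- Stochastic boundedness of a sequence of `[0, ∞]`-valued functions. -/
def StochasticallyBounded {Ω : ℕ → Type} [∀ n, MeasurableSpace (Ω n)] (μ : ∀ n, Measure (Ω n))
    (X : ∀ n, Ω n → ENNReal) : Prop :=
  ∀ ε : ENNReal, 0 < ε → ∃ K : NNReal, ∀ n : ℕ, 1 ≤ n → μ n {ω | (K : ENNReal) < X n ω} ≤ ε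

/-- Stability of scores: removing the last of `n` training pairs changes the score of the new pair
by a quantity that tends to `0` in probability (written with `n + 1` for `n`). -/
def StableScore (P : ∀ n, Measure (Obs (Y n) (p n))) (C : Score Y p) : Prop :=
  ∀ ε : ℝ, 0 < ε → Tendsto (fun n : ℕ => jointLaw P (n + 1)
    {w | ε ≤ |C (n + 1) (n + 1) w.2 w.1 - C (n + 1) n w.2 (Fin.init w.1)|}) atTop (𝓝 0)

/-- Asymptotic out-of-sample stability of an algorithm: removing the last of `n` training pairs
changes the prediction at the new feature vector by a quantity that tends to `0` in probability
(written with `n + 1` for `n`). -/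
def StableAlgorithm (P : ∀ n, Measure (Obs (Y n) (p n))) (A : Algorithm Y p) : Prop :=
  ∀ ε : ℝ, 0 < ε → Tendsto (fun n : ℕ => jointLaw P (n + 1)
    {w | ε ≤ |(A (n + 1) (n + 1) w.2.2 w.1 : ℝ) - (A (n + 1) n w.2.2 (Fin.init w.1) : ℝ)|})
    atTop (𝓝 0)

/-- The prediction error is bounded in probability. -/
def BoundedPredictionError (P : ∀ n, Measure (Obs (Y n) (p n))) (A : Algorithm Y p) : Prop :=
  StochasticallyBounded (jointLaw P)
    fun n w => ENNReal.ofReal |(w.2.1 : ℝ) - (A n n w.2.2 w.1 : ℝ)|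

/-- The continuous case assumption (CC): given almost every training data, the score of the new
pair has a density, and the supremum norms of these densities are stochastically bounded. -/
def ContinuousCase (P : ∀ n, Measure (Obs (Y n) (p n))) (C : Score Y p) : Prop :=
  ∃ f : ∀ n : ℕ, (Fin n → Obs (Y n) (p n)) → ℝ → ENNReal,
    (∀ n : ℕ, 1 ≤ n → ∀ᵐ T ∂trainLaw P n, Measurable (f n T) ∧
      (P n).map (fun z => C n n z T) = volume.withDensity (f n T)) ∧
    StochasticallyBounded (trainLaw P) fun n T => ⨆ s : ℝ, f n T s

/-- The conditional probability, given the training data `T`, that the prediction set for the new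
pair misses the new response. -/
def missProb (P : ∀ n, Measure (Obs (Y n) (p n))) (M : Method Y p) (n : ℕ) (α δ : ℝ)
    (T : Fin n → Obs (Y n) (p n)) : ℝ :=
  (P n).real {z | z.1 ∉ M n α δ T z.2}

/-- For every `δ > 0`, the `δ`-inflated prediction sets are asymptotically uniformly conditionally
conservative. -/
def InflatedConservative (P : ∀ n, Measure (Obs (Y n) (p n))) (M : Method Y p) : Prop :=
  ∀ δ : ℝ, 0 < δ → ∀ ε : ℝ, 0 < ε → Tendsto (fun n : ℕ => trainLaw P n
    {T | ε ≤ ⨆ α : Icc (0 : ℝ) 1, (missProb P M n α δ T - (α : ℝ))}) atTop (𝓝 0)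

/-- The non-inflated prediction sets are asymptotically uniformly conditionally valid. -/
def NonInflatedValid (P : ∀ n, Measure (Obs (Y n) (p n))) (M : Method Y p) : Prop :=
  Tendsto (fun n : ℕ => ∫⁻ T, ENNReal.ofReal
    (⨆ α : Icc (0 : ℝ) 1, |missProb P M n α 0 T - (α : ℝ)|) ∂trainLaw P n) atTop (𝓝 0)

/-- Asymptotic equivalence of two methods: conservativeness of the inflated sets holds for both or
for neither, and, in the continuous case for the score `C`, validity of the non-inflated sets holds
for both or for neither. -/
def AsympEquiv (P : ∀ n, Measure (Obs (Y n) (p n))) (C : Score Y p) (M₁ M₂ : Method Y p) : Prop :=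
  (InflatedConservative P M₁ ↔ InflatedConservative P M₂) ∧
  (ContinuousCase P C → (NonInflatedValid P M₁ ↔ NonInflatedValid P M₂))

/-- Conservativeness of the inflated sets, and validity of the non-inflated sets in the continuous
case for the score `C`. -/
def ConservativeAndValid (P : ∀ n, Measure (Obs (Y n) (p n))) (C : Score Y p) (M : Method Y p) :
    Prop :=
  InflatedConservative P M ∧ (ContinuousCase P C → NonInflatedValid P M)

end Asymptotics

end Conformal

end

open Set Filter Topology MeasureTheory

noncomputable section

namespace Conformal

/-! The equivalences hold because both sides of each are true: stability alone makes every method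
conservative after inflation, and valid under the density condition. Let `S` be the conditional
survival function of the score of a new pair given the training data. A prediction set would be
ideal if it missed the response exactly when `S` at the realised score is at most `α`, since `S`
evaluated at its own random variable is uniform up to atoms. `Follows` says that a method does this
up to shifts `ε` of the score and `κ` of the level, outside an event of vanishing probability that
serves all `α` at once. `Follows.inflatedConservative` absorbs the shift of the score into the
inflation `δ`. `Follows.nonInflatedValid` absorbs it through the bounded density, which makes `S`
Lipschitz.

That a stable score is followed is a weak law for the leave-one-out scores. For a Lipschitz `ψ` with
values in `[0, 1]`, the average over `i` of `ψ` (score of `t_i` without `t_i` minus new score) is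
compared with its analogue `copyMean`, in which an independent copy of the new pair replaces `t_i`.
Expanding the mean square of the difference gives products of two comparisons. By symmetry and
stability all the data sets in a product can be replaced by one data set that avoids the points
being compared, so every off-diagonal product has nearly the same mean `pairMoment` and these means
cancel (`integral_average_sub_copyMean_sq_le`). The diagonal contributes only `1 / (n + 1)`.

With `ψ` a ramp, such averages are squeezed between counts of comparisons, and `copyMean` between
values of `S`. Hence `follows_of_count`: a method follows the score once misses and covers are
controlled by counts of quantities close to those comparisons. Unwinding quantiles of empirical
distributions gives such counts for the shortcut, cross-conformal, full conformal and Jackknife+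
sets. The Jackknife is the shortcut for the out-of-sample score, and the oracle follows the score
directly from the definition of a quantile. -/

/-! ### The truncated distance -/

/-- The truncated distance of two real numbers. -/
def tdist (u v : ℝ) : ℝ := min 1 |u - v|

lemma tdist_nonneg (u v : ℝ) : 0 ≤ tdist u v := le_min zero_le_one (abs_nonneg _)

lemma tdist_le_one (u v : ℝ) : tdist u v ≤ 1 := min_le_left _ _

lemma tdist_le_abs (u v : ℝ) : tdist u v ≤ |u - v| := min_le_right _ _

lemma tdist_comm (u v : ℝ) : tdist u v = tdist v u := by rw [tdist, tdist, abs_sub_comm]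

/-- Truncation at `1` is monotone and subadditive on `[0, ∞)`. The truncated distance turns
convergence in probability into convergence of means, to which the triangle inequality can be
applied. -/
lemma tdist_le_of_abs_le_add {a b x y x' y' : ℝ} (h : |a - b| ≤ |x - y| + |x' - y'|) :
    tdist a b ≤ tdist x y + tdist x' y' := by
  unfold tdist
  rcases le_total 1 |x - y| with h1 | h1
  · rw [min_eq_left h1]
    have := min_le_left 1 |a - b|
    have : 0 ≤ min 1 |x' - y'| := le_min zero_le_one (abs_nonneg _)
    linarith
  rcases le_total 1 |x' - y'| with h2 | h2
  · rw [min_eq_left h2]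
    have := min_le_left 1 |a - b|
    have : 0 ≤ min 1 |x - y| := le_min zero_le_one (abs_nonneg _)
    linarith
  rw [min_eq_right h1, min_eq_right h2]
  exact (min_le_right _ _).trans h

lemma tdist_triangle (u v w : ℝ) : tdist u w ≤ tdist u v + tdist v w :=
  tdist_le_of_abs_le_add (abs_sub_le u v w)

lemma tdist_sub_sub_le (a b a' b' : ℝ) : tdist (a - b) (a' - b') ≤ tdist a a' + tdist b b' := by
  refine tdist_le_of_abs_le_add ?_
  rw [show a - b - (a' - b') = (a - a') - (b - b') by ring]
  exact abs_sub _ _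

lemma tdist_mono {a b x y : ℝ} (h : |a - b| ≤ |x - y|) : tdist a b ≤ tdist x y :=
  min_le_min_left _ h

@[fun_prop]
lemma measurable_tdist {Ω : Type*} [MeasurableSpace Ω] {f g : Ω → ℝ} (hf : Measurable f)
    (hg : Measurable g) : Measurable fun ω => tdist (f ω) (g ω) := by
  unfold Conformal.tdist
  fun_prop

lemma integrable_of_abs_le_one {Ω : Type*} [MeasurableSpace Ω] {μ : Measure Ω}
    [IsFiniteMeasure μ] {f : Ω → ℝ} (hf : Measurable f) (h : ∀ ω, |f ω| ≤ 1) :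
    Integrable f μ :=
  Integrable.of_bound hf.aestronglyMeasurable 1 (ae_of_all _ h)

lemma integrable_tdist {Ω : Type*} [MeasurableSpace Ω] {μ : Measure Ω} [IsFiniteMeasure μ]
    {f g : Ω → ℝ} (hf : Measurable f) (hg : Measurable g) :
    Integrable (fun ω => tdist (f ω) (g ω)) μ :=
  integrable_of_abs_le_one (measurable_tdist hf hg) fun ω => by
    rw [abs_of_nonneg (tdist_nonneg _ _)]; exact tdist_le_one _ _

/-- Integrals are preserved by measure preserving maps that need not be embeddings. -/
lemma integral_comp_of_measurePreserving {Ω Ω' : Type*} [MeasurableSpace Ω] [MeasurableSpace Ω']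
    {μ : Measure Ω} {ν : Measure Ω'} {φ : Ω → Ω'} (h : MeasurePreserving φ μ ν) {f : Ω' → ℝ}
    (hf : Measurable f) : ∫ ω, f (φ ω) ∂μ = ∫ w, f w ∂ν := by
  rw [← h.map_eq, integral_map h.measurable.aemeasurable hf.aestronglyMeasurable]

/-! ### I.i.d. sequences -/

section Iid

variable {Z : Type*} [MeasurableSpace Z] (μ : Measure Z) [IsProbabilityMeasure μ]

/-- The law of an i.i.d. sequence. -/
abbrev seqLaw : Measure (ℕ → Z) := Measure.infinitePi fun _ => μ

/-- Exchangeability is handled on a single i.i.d. sequence: distinct coordinates are again i.i.d.,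
so the law of an expression depends only on the pattern of coincidences among its indices. -/
lemma measurePreserving_reindex {ι : Type*} [Fintype ι] {σ : ι → ℕ}
    (hσ : Function.Injective σ) :
    MeasurePreserving (fun (ω : ℕ → Z) i => ω (σ i)) (seqLaw μ) (Measure.pi fun _ => μ) := by
  refine ⟨by fun_prop, ?_⟩
  rw [Measure.map_infinitePi_infinitePi_of_inj hσ, Measure.infinitePi_eq_pi]

lemma measurePreserving_reindex_prod {ι κ : Type*} [Fintype ι] [Fintype κ] {σ : ι → ℕ}
    {ρ : κ → ℕ} (hσ : Function.Injective σ) (hρ : Function.Injective ρ)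
    (h : ∀ i k, σ i ≠ ρ k) :
    MeasurePreserving (fun (ω : ℕ → Z) => (fun i => ω (σ i), fun k => ω (ρ k))) (seqLaw μ)
      ((Measure.pi fun _ => μ).prod (Measure.pi fun _ => μ)) :=
  (measurePreserving_sumPiEquivProdPi (X := fun _ : ι ⊕ κ => Z) (fun _ => μ)).comp
    (measurePreserving_reindex μ (hσ.sumElim hρ h))

lemma measurePreserving_train_new {m : ℕ} {e : Fin m → ℕ} (he : Function.Injective e) {a : ℕ}
    (ha : ∀ i, e i ≠ a) :
    MeasurePreserving (fun (ω : ℕ → Z) => (fun i => ω (e i), ω a)) (seqLaw μ)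
      ((Measure.pi fun _ => μ).prod μ) :=
  ((MeasurePreserving.id _).prod (measurePreserving_funUnique μ Unit)).comp
    (measurePreserving_reindex_prod μ he (ρ := fun _ : Unit => a)
      (Function.injective_of_subsingleton _) fun i _ => ha i)

lemma measurePreserving_train_new_two {m : ℕ} {e : Fin m → ℕ} (he : Function.Injective e)
    {a b c : ℕ} (ha : ∀ i, e i ≠ a) (hb : ∀ i, e i ≠ b) (hc : ∀ i, e i ≠ c) (hab : a ≠ b)
    (hac : a ≠ c) (hbc : b ≠ c) :
    MeasurePreserving (fun (ω : ℕ → Z) => ((fun i => ω (e i), ω a), (ω b, ω c))) (seqLaw μ)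
      (((Measure.pi fun _ => μ).prod μ).prod (μ.prod μ)) := by
  have h1 : Function.Injective (Sum.elim e fun _ : Unit => a) :=
    he.sumElim (Function.injective_of_subsingleton _) fun i _ => ha i
  have h2 : Function.Injective ![b, c] := by
    intro i j; fin_cases i <;> fin_cases j <;> simp [hbc, hbc.symm]
  have h3 := measurePreserving_reindex_prod μ h1 h2 (by
    rintro (i | i) k <;> fin_cases k <;> simp [hb, hc, hab, hac])
  exact ((((MeasurePreserving.id _).prod (measurePreserving_funUnique μ Unit)).comp
    (measurePreserving_sumPiEquivProdPi (X := fun _ : Fin m ⊕ Unit => Z) (fun _ => μ))).prod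
      (measurePreserving_finTwoArrow μ)).comp h3

end Iid

/-! ### Scores indexed by finite sets -/

/-- The score of the `a`-th member of the sequence `ω` with respect to the members in `s`. -/
def seqScore {Z : Type*} (g : ∀ m : ℕ, Z → (Fin m → Z) → ℝ) (a : ℕ) (s : Finset ℕ)
    (ω : ℕ → Z) : ℝ :=
  g s.card (ω a) fun j => ω (s.equivFin.symm j)

/-- By symmetry only the set of indices of the data points matters, so the arbitrary enumeration
inside `seqScore` is harmless. Data sets can then be manipulated as finite sets. -/
lemma score_eq_seqScore {Z : Type*} {g : ∀ m : ℕ, Z → (Fin m → Z) → ℝ}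
    (hs : ∀ m z T (π : Equiv.Perm (Fin m)), g m z (fun j => T (π j)) = g m z T)
    {m : ℕ} {e : Fin m → ℕ} (he : Function.Injective e) {s : Finset ℕ}
    (hes : ∀ x, x ∈ s ↔ ∃ j, e j = x) (a : ℕ) (ω : ℕ → Z) :
    g m (ω a) (fun j => ω (e j)) = seqScore g a s ω := by
  have hcard : s.card = m := by
    have : s = Finset.univ.image e := by ext x; simp [hes]
    rw [this, Finset.card_image_of_injective _ he, Finset.card_univ, Fintype.card_fin]
  subst hcard
  have hmem : ∀ j, e j ∈ s := fun j => (hes _).2 ⟨j, rfl⟩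
  let f : Fin s.card → Fin s.card := fun j => s.equivFin ⟨e j, hmem j⟩
  have hf : Function.Injective f := fun i j h => by
    have := s.equivFin.injective h
    exact he (Subtype.ext_iff.1 this)
  have := hs s.card (ω a) (fun j => ω (s.equivFin.symm j))
    (Equiv.ofBijective f (Finite.injective_iff_bijective.1 hf))
  simpa [f, seqScore] using this

section Symmetric

variable {Z : Type*} [MeasurableSpace Z] (μ : Measure Z) [IsProbabilityMeasure μ]
  (g : ∀ m : ℕ, Z → (Fin m → Z) → ℝ)

variable {g}

lemma measurable_seqScore (hg : ∀ m, Measurable fun w : Z × (Fin m → Z) => g m w.1 w.2)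
    (a : ℕ) (s : Finset ℕ) : Measurable (seqScore g a s) :=
  (hg s.card).comp (g := fun w : Z × (Fin s.card → Z) => g s.card w.1 w.2)
    (f := fun ω : ℕ → Z => (ω a, fun j => ω (s.equivFin.symm j))) (by fun_prop)

variable (g) in
/-- The mean truncated effect on the score of a new point of deleting the last of `n + 1` data
points. -/
def instability (n : ℕ) : ℝ :=
  ∫ w : (Fin (n + 1) → Z) × Z, tdist (g (n + 1) w.2 w.1) (g n w.2 (Fin.init w.1))
    ∂((Measure.pi fun _ => μ).prod μ)

/-- Since `a`, `b` and the members of `s` are distinct indices, the joint law is that of a new point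
and a data set of size `s.card + 1`, whichever indices are chosen. -/
lemma integral_tdist_insert (hg : ∀ m, Measurable fun w : Z × (Fin m → Z) => g m w.1 w.2)
    (hs : ∀ m z T (π : Equiv.Perm (Fin m)), g m z (fun j => T (π j)) = g m z T)
    {s : Finset ℕ} {a b : ℕ} (hb : b ∉ s) (ha : a ∉ insert b s) :
    ∫ ω, tdist (seqScore g a (insert b s) ω) (seqScore g a s ω) ∂seqLaw μ
      = instability μ g s.card := by
  let e : Fin s.card → ℕ := fun j => s.equivFin.symm j
  have he : Function.Injective e := Subtype.val_injective.comp s.equivFin.symm.injective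
  have hes : ∀ x, x ∈ s ↔ ∃ j, e j = x := fun x =>
    ⟨fun hx => ⟨s.equivFin ⟨x, hx⟩, by simp [e]⟩, by rintro ⟨j, rfl⟩; exact (s.equivFin.symm j).2⟩
  -- The index `b` is enumerated last, so that `Fin.init` removes exactly this point.
  let e' : Fin (s.card + 1) → ℕ := Fin.snoc e b
  have he' : Function.Injective e' :=
    Fin.snoc_injective_iff.2 ⟨he, fun ⟨j, hj⟩ => hb ((hes _).2 ⟨j, hj⟩)⟩
  have hes' : ∀ x, x ∈ insert b s ↔ ∃ j, e' j = x := fun x => by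
    rw [Finset.mem_insert, hes]
    constructor
    · rintro (rfl | ⟨j, rfl⟩)
      · exact ⟨Fin.last _, by simp [e']⟩
      · exact ⟨j.castSucc, by simp [e']⟩
    · rintro ⟨j, rfl⟩
      induction j using Fin.lastCases with
      | last => simp [e']
      | cast j => exact Or.inr ⟨j, by simp [e']⟩
  have hmp := measurePreserving_train_new μ he' (a := a) fun i h => ha ((hes' _).2 ⟨i, h⟩)
  have hm := hg (s.card + 1)
  have hm' := hg s.card
  rw [instability, ← integral_comp_of_measurePreserving hmp]
  · refine integral_congr_ae (ae_of_all _ fun ω => ?_)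
    simp only
    rw [← score_eq_seqScore hs he' hes', ← score_eq_seqScore hs he hes]
    congr 2
    ext j
    simp [Fin.init, e']
  · refine measurable_tdist (hm.comp (measurable_snd.prodMk measurable_fst))
      (hm'.comp (measurable_snd.prodMk ?_))
    exact measurable_pi_lambda _ fun j => (measurable_pi_apply _).comp measurable_fst

lemma integral_tdist_triangle (hg : ∀ m, Measurable fun w : Z × (Fin m → Z) => g m w.1 w.2)
    (a : ℕ) (s t r : Finset ℕ) :
    ∫ ω, tdist (seqScore g a s ω) (seqScore g a r ω) ∂seqLaw μ ≤
      ∫ ω, tdist (seqScore g a s ω) (seqScore g a t ω) ∂seqLaw μ +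
      ∫ ω, tdist (seqScore g a t ω) (seqScore g a r ω) ∂seqLaw μ := by
  have h := fun s => measurable_seqScore hg a s
  rw [← integral_add (integrable_tdist (h s) (h t)) (integrable_tdist (h t) (h r))]
  exact integral_mono (integrable_tdist (h s) (h r))
    ((integrable_tdist (h s) (h t)).add (integrable_tdist (h t) (h r)))
    fun ω => tdist_triangle _ _ _

/-- Replacing one data point. -/
lemma integral_tdist_replace (hg : ∀ m, Measurable fun w : Z × (Fin m → Z) => g m w.1 w.2)
    (hs : ∀ m z T (π : Equiv.Perm (Fin m)), g m z (fun j => T (π j)) = g m z T)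
    {s : Finset ℕ} {a b c : ℕ} (hb : b ∉ s) (hc : c ∉ s) (hbc : b ≠ c) (ha : a ∉ s)
    (hab : a ≠ b) (hac : a ≠ c) :
    ∫ ω, tdist (seqScore g a (insert b s) ω) (seqScore g a (insert c s) ω) ∂seqLaw μ
      ≤ 2 * instability μ g (s.card + 1) := by
  -- Pass through the data set containing both points; each half deletes one point from it and costs
  -- one instability.
  refine (integral_tdist_triangle μ hg a _ (insert b (insert c s)) _).trans ?_
  have h1 := integral_tdist_insert μ hg hs (s := insert c s) (a := a) (b := b)
    (by simp [hb, hbc]) (by simp [ha, hab, hac])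
  have h2 := integral_tdist_insert μ hg hs (s := insert b s) (a := a) (b := c)
    (by simp [hc, hbc.symm]) (by simp [ha, hab, hac])
  rw [Finset.card_insert_of_notMem hc] at h1
  rw [Finset.card_insert_of_notMem hb, Finset.insert_comm] at h2
  simp only [tdist_comm (seqScore g a (insert b s) _)]
  rw [h1, h2]
  linarith

end Symmetric

/-! ### The second moment of the leave-one-out average -/

/-- Lipschitz functions with values in the unit interval. -/
structure IsUnitLipschitz (ψ : ℝ → ℝ) (L : ℝ) : Prop where
  nonneg : ∀ u, 0 ≤ ψ u
  le_one : ∀ u, ψ u ≤ 1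
  one_le : 1 ≤ L
  lipschitz : ∀ u v, |ψ u - ψ v| ≤ L * |u - v|

namespace IsUnitLipschitz

variable {ψ : ℝ → ℝ} {L : ℝ} (hψ : IsUnitLipschitz ψ L)

include hψ

lemma measurable : Measurable ψ :=
  (LipschitzWith.of_dist_le_mul (K := L.toNNReal) fun u v => by
    rw [Real.coe_toNNReal _ (zero_le_one.trans hψ.one_le)]
    exact hψ.lipschitz u v).continuous.measurable

lemma abs_le_one (u : ℝ) : |ψ u| ≤ 1 := abs_le.2 ⟨by linarith [hψ.nonneg u], hψ.le_one u⟩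

/-- Where the truncated distance equals `1`, the oscillation of `ψ` is still at most `1 ≤ L`; this
is the purpose of requiring `1 ≤ L`. -/
lemma abs_sub_le (u v : ℝ) : |ψ u - ψ v| ≤ L * tdist u v := by
  unfold tdist
  rcases min_choice 1 |u - v| with h | h <;> rw [h]
  · have := hψ.one_le
    rw [mul_one, abs_le]
    constructor <;> linarith [hψ.nonneg u, hψ.nonneg v, hψ.le_one u, hψ.le_one v]
  · exact hψ.lipschitz u v

lemma abs_mul_sub_mul_le (u v u' v' : ℝ) :
    |ψ u * ψ v - ψ u' * ψ v'| ≤ L * (tdist u u' + tdist v v') := by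
  rw [show ψ u * ψ v - ψ u' * ψ v' = (ψ u - ψ u') * ψ v + ψ u' * (ψ v - ψ v') by ring]
  refine (abs_add_le _ _).trans ?_
  rw [abs_mul, abs_mul, mul_add]
  refine add_le_add ?_ ?_
  · exact (mul_le_of_le_one_right (abs_nonneg _) (hψ.abs_le_one _)).trans (hψ.abs_sub_le _ _)
  · exact (mul_le_of_le_one_left (abs_nonneg _) (hψ.abs_le_one _)).trans (hψ.abs_sub_le _ _)

end IsUnitLipschitz

section SecondMoment

variable {Z : Type*} [MeasurableSpace Z] (μ : Measure Z) [IsProbabilityMeasure μ]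
  {g : ∀ m : ℕ, Z → (Fin m → Z) → ℝ} {ψ : ℝ → ℝ} {L : ℝ}

variable (g ψ) in
/-- The joint moment of the comparisons of two new points with a third one, based on the same
data set of size `n`. -/
def pairMoment (n : ℕ) : ℝ :=
  ∫ v : Fin n ⊕ Fin 3 → Z,
    ψ (g n (v (.inr 0)) (fun j => v (.inl j)) - g n (v (.inr 2)) (fun j => v (.inl j))) *
      ψ (g n (v (.inr 1)) (fun j => v (.inl j)) - g n (v (.inr 2)) (fun j => v (.inl j)))
    ∂Measure.pi fun _ => μ

lemma integral_pair_eq (hg : ∀ m, Measurable fun w : Z × (Fin m → Z) => g m w.1 w.2)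
    (hψ : Measurable ψ) {s : Finset ℕ} {a b c : ℕ} (ha : a ∉ s) (hb : b ∉ s) (hc : c ∉ s)
    (hab : a ≠ b) (hac : a ≠ c) (hbc : b ≠ c) :
    ∫ ω, ψ (seqScore g a s ω - seqScore g c s ω) * ψ (seqScore g b s ω - seqScore g c s ω)
      ∂seqLaw μ = pairMoment μ g ψ s.card := by
  let e : Fin s.card → ℕ := fun j => s.equivFin.symm j
  have he : Function.Injective e := Subtype.val_injective.comp s.equivFin.symm.injective
  have hes : ∀ j, e j ∈ s := fun j => (s.equivFin.symm j).2
  have h3 : Function.Injective ![a, b, c] := by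
    intro i j; fin_cases i <;> fin_cases j <;> simp [hab, hac, hbc, hab.symm, hac.symm, hbc.symm]
  have hmp := measurePreserving_reindex μ (he.sumElim h3 (by
    intro i k h
    have := hes i
    rw [h] at this
    fin_cases k <;> simp_all))
  have hm := hg s.card
  rw [pairMoment, ← integral_comp_of_measurePreserving hmp]
  · simp [seqScore, e]
  · have key : ∀ k : Fin 3, Measurable fun v : Fin s.card ⊕ Fin 3 → Z =>
        g s.card (v (.inr k)) (fun j => v (.inl j)) := fun k =>
      hm.comp (g := fun w : Z × (Fin s.card → Z) => g s.card w.1 w.2)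
        (f := fun v : Fin s.card ⊕ Fin 3 → Z => (v (.inr k), fun j => v (.inl j))) (by fun_prop)
    exact (hψ.comp ((key 0).sub (key 2))).mul (hψ.comp ((key 1).sub (key 2)))

/-- All three moment estimates below come from this replacement of three data sets by a common `D`
that avoids the compared points. The error `r₃` is doubled because the score of `c` enters both
factors. -/
lemma abs_integral_sub_pairMoment_le
    (hg : ∀ m, Measurable fun w : Z × (Fin m → Z) => g m w.1 w.2)
    (hψ : IsUnitLipschitz ψ L) {s₁ s₂ s₃ D : Finset ℕ} {a b c : ℕ} (ha : a ∉ D) (hb : b ∉ D)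
    (hc : c ∉ D) (hab : a ≠ b) (hac : a ≠ c) (hbc : b ≠ c) {r₁ r₂ r₃ : ℝ}
    (h₁ : ∫ ω, tdist (seqScore g a s₁ ω) (seqScore g a D ω) ∂seqLaw μ ≤ r₁)
    (h₂ : ∫ ω, tdist (seqScore g b s₂ ω) (seqScore g b D ω) ∂seqLaw μ ≤ r₂)
    (h₃ : ∫ ω, tdist (seqScore g c s₃ ω) (seqScore g c D ω) ∂seqLaw μ ≤ r₃) :
    |∫ ω, ψ (seqScore g a s₁ ω - seqScore g c s₃ ω) * ψ (seqScore g b s₂ ω - seqScore g c s₃ ω)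
      ∂seqLaw μ - pairMoment μ g ψ D.card| ≤ L * (r₁ + r₂ + 2 * r₃) := by
  have hK := fun a s => measurable_seqScore hg a s
  have hψm := hψ.measurable
  have hint : ∀ s s' t, Integrable (fun ω => ψ (seqScore g a s ω - seqScore g c t ω) *
      ψ (seqScore g b s' ω - seqScore g c t ω)) (seqLaw μ) := fun s s' t => by
    refine integrable_of_abs_le_one ((hψm.comp ((hK a s).sub (hK c t))).mul
      (hψm.comp ((hK b s').sub (hK c t)))) fun ω => ?_
    rw [abs_mul]
    exact mul_le_one₀ (hψ.abs_le_one _) (abs_nonneg _) (hψ.abs_le_one _)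
  have i₁ := integrable_tdist (μ := seqLaw μ) (hK a s₁) (hK a D)
  have i₂ := integrable_tdist (μ := seqLaw μ) (hK b s₂) (hK b D)
  have i₃ := integrable_tdist (μ := seqLaw μ) (hK c s₃) (hK c D)
  have hL : 0 ≤ L := zero_le_one.trans hψ.one_le
  rw [← integral_pair_eq μ hg hψm ha hb hc hab hac hbc, ← integral_sub (hint _ _ _) (hint _ _ _)]
  refine (abs_integral_le_integral_abs).trans ?_
  calc _ ≤ ∫ ω, L * (tdist (seqScore g a s₁ ω) (seqScore g a D ω) +
        tdist (seqScore g b s₂ ω) (seqScore g b D ω) +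
        2 * tdist (seqScore g c s₃ ω) (seqScore g c D ω)) ∂seqLaw μ := by
        refine integral_mono ((hint _ _ _).sub (hint _ _ _)).abs
          (((i₁.add i₂).add (i₃.const_mul 2)).const_mul L) fun ω => ?_
        refine (hψ.abs_mul_sub_mul_le _ _ _ _).trans (mul_le_mul_of_nonneg_left ?_ hL)
        have := tdist_sub_sub_le (seqScore g a s₁ ω) (seqScore g c s₃ ω) (seqScore g a D ω)
          (seqScore g c D ω)
        have := tdist_sub_sub_le (seqScore g b s₂ ω) (seqScore g c s₃ ω) (seqScore g b D ω)
          (seqScore g c D ω)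
        linarith
    _ = L * (∫ ω, tdist (seqScore g a s₁ ω) (seqScore g a D ω) ∂seqLaw μ +
        ∫ ω, tdist (seqScore g b s₂ ω) (seqScore g b D ω) ∂seqLaw μ +
        2 * ∫ ω, tdist (seqScore g c s₃ ω) (seqScore g c D ω) ∂seqLaw μ) := by
        have i₁₂ : Integrable (fun ω => tdist (seqScore g a s₁ ω) (seqScore g a D ω) +
          tdist (seqScore g b s₂ ω) (seqScore g b D ω)) (seqLaw μ) := i₁.add i₂
        rw [integral_const_mul, integral_add i₁₂ (i₃.const_mul 2), integral_add i₁ i₂,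
          integral_const_mul]
    _ ≤ _ := mul_le_mul_of_nonneg_left (by linarith) hL

end SecondMoment

/-! ### Training data and new points inside one sequence -/

section Joint

variable {Z : Type*} {g : ∀ m : ℕ, Z → (Fin m → Z) → ℝ}

variable (g) in
/-- The score of the new point. -/
def newScore (n : ℕ) (w : (Fin (n + 1) → Z) × Z) : ℝ := g (n + 1) w.2 w.1

variable (g) in
/-- The leave-one-out scores of the data points. -/
def looScore (n : ℕ) (w : (Fin (n + 1) → Z) × Z) (i : Fin (n + 1)) : ℝ :=
  g n (w.1 i) (i.removeNth w.1)

/-- Training data and a new point from a sequence. -/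
def trainNew (n : ℕ) (ω : ℕ → Z) : (Fin (n + 1) → Z) × Z := (fun j => ω j, ω (n + 1))

lemma newScore_trainNew
    (hs : ∀ m z T (π : Equiv.Perm (Fin m)), g m z (fun j => T (π j)) = g m z T) (n a : ℕ)
    (ω : ℕ → Z) :
    newScore g n ((trainNew n ω).1, ω a) = seqScore g a (Finset.range (n + 1)) ω :=
  score_eq_seqScore hs Fin.val_injective (fun x => by
    rw [Finset.mem_range]
    exact ⟨fun h => ⟨⟨x, h⟩, rfl⟩, by rintro ⟨j, rfl⟩; exact j.2⟩) _ _

lemma score_removeNth_trainNew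
    (hs : ∀ m z T (π : Equiv.Perm (Fin m)), g m z (fun j => T (π j)) = g m z T) (n a : ℕ)
    (i : Fin (n + 1)) (ω : ℕ → Z) :
    g n (ω a) (i.removeNth (trainNew n ω).1)
      = seqScore g a ((Finset.range (n + 1)).erase i) ω := by
  refine score_eq_seqScore hs (e := fun j => ((i.succAbove j : Fin (n + 1)) : ℕ))
    (Fin.val_injective.comp Fin.succAbove_right_injective) (fun x => ?_) _ _
  rw [Finset.mem_erase, Finset.mem_range]
  constructor
  · rintro ⟨h1, h2⟩
    obtain ⟨j, hj⟩ := Fin.exists_succAbove_eq (x := (⟨x, h2⟩ : Fin (n + 1))) (y := i)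
      (fun h => h1 (by rw [← h]))
    exact ⟨j, by rw [hj]⟩
  · rintro ⟨j, rfl⟩
    exact ⟨fun h => Fin.succAbove_ne i j (Fin.ext h), (i.succAbove j).2⟩

lemma looScore_trainNew
    (hs : ∀ m z T (π : Equiv.Perm (Fin m)), g m z (fun j => T (π j)) = g m z T) (n : ℕ)
    (i : Fin (n + 1)) (ω : ℕ → Z) :
    looScore g n (trainNew n ω) i = seqScore g i ((Finset.range (n + 1)).erase i) ω :=
  score_removeNth_trainNew hs n i i ω

end Joint

/-! ### Moment estimates for the leave-one-out comparisons -/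

section JointMoments

variable {Z : Type*} [MeasurableSpace Z] (μ : Measure Z) [IsProbabilityMeasure μ]
  {g : ∀ m : ℕ, Z → (Fin m → Z) → ℝ} {ψ : ℝ → ℝ} {L : ℝ}

variable (g ψ) in
/-- The conditional mean, given the training data and the new point, of the comparison of the score
of an independent copy with the score of the new point. -/
def copyMean (n : ℕ) (w : (Fin (n + 1) → Z) × Z) : ℝ :=
  ∫ z, ψ (newScore g n (w.1, z) - newScore g n w) ∂μ

lemma measurable_score_comp {Ω : Type*} [MeasurableSpace Ω]
    (hg : ∀ m, Measurable fun w : Z × (Fin m → Z) => g m w.1 w.2) {m : ℕ} {ζ : Ω → Z}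
    {T : Ω → Fin m → Z} (hζ : Measurable ζ) (hT : Measurable T) :
    Measurable fun ω => g m (ζ ω) (T ω) :=
  (hg m).comp (hζ.prodMk hT)

lemma measurable_newScore (hg : ∀ m, Measurable fun w : Z × (Fin m → Z) => g m w.1 w.2) (n : ℕ) :
    Measurable (newScore g n) :=
  measurable_score_comp hg measurable_snd measurable_fst

lemma measurable_removeNth {n : ℕ} (i : Fin (n + 1)) :
    Measurable fun T : Fin (n + 1) → Z => i.removeNth T :=
  measurable_pi_lambda _ fun _ => measurable_pi_apply _

lemma measurable_looScore (hg : ∀ m, Measurable fun w : Z × (Fin m → Z) => g m w.1 w.2) (n : ℕ)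
    (i : Fin (n + 1)) : Measurable fun w => looScore g n w i :=
  measurable_score_comp hg (by fun_prop) ((measurable_removeNth i).comp measurable_fst)

lemma measurable_copy (hg : ∀ m, Measurable fun w : Z × (Fin m → Z) => g m w.1 w.2) (n : ℕ)
    (hψ : Measurable ψ) : Measurable fun v : ((Fin (n + 1) → Z) × Z) × Z =>
      ψ (newScore g n (v.1.1, v.2) - newScore g n v.1) :=
  hψ.comp (((measurable_newScore hg n).comp (by fun_prop)).sub
    ((measurable_newScore hg n).comp measurable_fst))

lemma measurable_copyMean (hg : ∀ m, Measurable fun w : Z × (Fin m → Z) => g m w.1 w.2) (n : ℕ)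
    (hψ : Measurable ψ) : Measurable (copyMean μ g ψ n) :=
  (measurable_copy hg n hψ).stronglyMeasurable.integral_prod_right'.measurable

lemma measurable_loo (hg : ∀ m, Measurable fun w : Z × (Fin m → Z) => g m w.1 w.2) (n : ℕ)
    (hψ : Measurable ψ) (i : Fin (n + 1)) :
    Measurable fun w => ψ (looScore g n w i - newScore g n w) :=
  hψ.comp ((measurable_looScore hg n i).sub (measurable_newScore hg n))

lemma copyMean_mem (hg : ∀ m, Measurable fun w : Z × (Fin m → Z) => g m w.1 w.2) (n : ℕ)
    (hψ : IsUnitLipschitz ψ L) (w : (Fin (n + 1) → Z) × Z) :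
    0 ≤ copyMean μ g ψ n w ∧ copyMean μ g ψ n w ≤ 1 := by
  refine ⟨integral_nonneg fun _ => hψ.nonneg _, ?_⟩
  calc copyMean μ g ψ n w ≤ ∫ _, (1 : ℝ) ∂μ := by
        refine integral_mono (integrable_of_abs_le_one ?_ fun _ => hψ.abs_le_one _)
          (integrable_const _) fun _ => hψ.le_one _
        exact (measurable_copy hg n hψ.measurable).comp measurable_prodMk_left
    _ = 1 := by simp

/-- The law of the training data and the new point. -/
abbrev pairLaw (n : ℕ) : Measure ((Fin (n + 1) → Z) × Z) := (Measure.pi fun _ => μ).prod μ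

lemma measurePreserving_trainNew (n : ℕ) :
    MeasurePreserving (trainNew n) (seqLaw μ) (pairLaw μ n) :=
  measurePreserving_train_new μ Fin.val_injective fun i => by have := i.2; omega

lemma measurePreserving_trainNew_two (n : ℕ) :
    MeasurePreserving (fun ω : ℕ → Z => (trainNew n ω, (ω (n + 2), ω (n + 3)))) (seqLaw μ)
      ((pairLaw μ n).prod (μ.prod μ)) :=
  measurePreserving_train_new_two μ Fin.val_injective (fun i => by have := i.2; omega)
    (fun i => by have := i.2; omega) (fun i => by have := i.2; omega) (by omega) (by omega)
    (by omega)

variable (hg : ∀ m, Measurable fun w : Z × (Fin m → Z) => g m w.1 w.2)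
  (hs : ∀ m z T (π : Equiv.Perm (Fin m)), g m z (fun j => T (π j)) = g m z T)
  (hψ : IsUnitLipschitz ψ L)

include hg hs

lemma integral_tdist_new_erase (n : ℕ) {i a : ℕ} (hi : i < n + 1) (ha : n < a) :
    ∫ ω, tdist (seqScore g a (Finset.range (n + 1)) ω)
      (seqScore g a ((Finset.range (n + 1)).erase i) ω) ∂seqLaw μ ≤ instability μ g n := by
  have hmem : i ∈ Finset.range (n + 1) := Finset.mem_range.2 hi
  have := integral_tdist_insert μ hg hs (s := (Finset.range (n + 1)).erase i) (a := a) (b := i)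
    (Finset.notMem_erase _ _) (by rw [Finset.insert_erase hmem, Finset.mem_range]; omega)
  rw [Finset.insert_erase hmem, Finset.card_erase_of_mem hmem, Finset.card_range] at this
  exact this.le

include hψ

/-- The two leave-one-out data sets each contain the other compared point, which a fresh point
replaces at cost `2` in units of the instability. The full data set of the new point loses one point
and has another replaced, at cost `3`, counted twice: `2 + 2 + 2 * 3 = 10`. -/
lemma abs_integral_loo_mul_loo_sub_le (n : ℕ) {i j : Fin (n + 1)} (hij : i ≠ j) :
    |∫ w, ψ (looScore g n w i - newScore g n w) * ψ (looScore g n w j - newScore g n w)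
      ∂pairLaw μ n - pairMoment μ g ψ n| ≤ L * (10 * instability μ g n) := by
  have hm : Measurable fun w => ψ (looScore g n w i - newScore g n w) *
      ψ (looScore g n w j - newScore g n w) :=
    (measurable_loo hg n hψ.measurable i).mul (measurable_loo hg n hψ.measurable j)
  rw [← integral_comp_of_measurePreserving (measurePreserving_trainNew μ n) hm]
  have e (ω : ℕ → Z) : newScore g n (trainNew n ω)
      = seqScore g (n + 1) (Finset.range (n + 1)) ω := newScore_trainNew hs n (n + 1) ω
  simp only [looScore_trainNew hs, e]
  have hij' : (i : ℕ) ≠ j := fun h => hij (Fin.ext h)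
  have hi := i.2
  have hj := j.2
  -- The common data set will be `s` with the fresh index `n + 2`: it has size `n` and avoids `i`,
  -- `j` and the new point `n + 1`.
  set s := ((Finset.range (n + 1)).erase i).erase j with hsdef
  have his : (i : ℕ) ∉ s := by simp [hsdef]
  have hjs : (j : ℕ) ∉ s := by simp [hsdef]
  have hns : ∀ k, n < k → k ∉ s := fun k hk => by
    simp only [hsdef, Finset.mem_erase, Finset.mem_range]; omega
  have hi1 : (Finset.range (n + 1)).erase i = insert (j : ℕ) s := by
    rw [hsdef, Finset.insert_erase]; simp [hij'.symm, hj]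
  have hj1 : (Finset.range (n + 1)).erase j = insert (i : ℕ) s := by
    rw [hsdef, Finset.erase_right_comm, Finset.insert_erase]; simp [hij', Nat.le_of_lt_succ hi]
  have hcard : s.card + 1 = n := by
    rw [← Finset.card_insert_of_notMem hjs, ← hi1, Finset.card_erase_of_mem (Finset.mem_range.2 hi),
      Finset.card_range]
    simp
  have hD : (insert (n + 2) s).card = n := by
    rw [Finset.card_insert_of_notMem (hns _ (by omega)), hcard]
  have h1 := integral_tdist_replace μ hg hs (s := s) (a := i) (b := j) (c := n + 2) hjs
    (hns _ (by omega)) (by omega) his hij' (by omega)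
  have h2 := integral_tdist_replace μ hg hs (s := s) (a := j) (b := i) (c := n + 2) his
    (hns _ (by omega)) (by omega) hjs hij'.symm (by omega)
  have h3 := integral_tdist_replace μ hg hs (s := s) (a := n + 1) (b := j) (c := n + 2) hjs
    (hns _ (by omega)) (by omega) (hns _ (by omega)) (by omega) (by omega)
  have h4 := (integral_tdist_triangle μ hg (n + 1) (Finset.range (n + 1)) _ _).trans
    (add_le_add (integral_tdist_new_erase μ hg hs n hi (a := n + 1) (by omega)) (hi1 ▸ h3))
  rw [hcard] at h1 h2 h4
  have := abs_integral_sub_pairMoment_le μ hg hψ (D := insert (n + 2) s) (a := i) (b := j)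
    (c := n + 1) (by simp [his]; omega) (by simp [hjs]; omega) (by simp [hns]) hij' (by omega)
    (by omega) (hi1 ▸ h1) (hj1 ▸ h2) h4
  rw [hD] at this
  refine this.trans (le_of_eq ?_)
  ring

/-- Here `copyMean` is realised by a further point of the sequence. The data set without `i` already
avoids every compared point, so the costs are `0`, `1` and `2 * 1`. -/
lemma abs_integral_loo_mul_copyMean_sub_le (n : ℕ) (i : Fin (n + 1)) :
    |∫ w, ψ (looScore g n w i - newScore g n w) * copyMean μ g ψ n w
      ∂pairLaw μ n - pairMoment μ g ψ n| ≤ L * (3 * instability μ g n) := by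
  have hm : Measurable fun v : ((Fin (n + 1) → Z) × Z) × (Z × Z) =>
      ψ (looScore g n v.1 i - newScore g n v.1) *
        ψ (newScore g n (v.1.1, v.2.1) - newScore g n v.1) :=
    ((measurable_loo hg n hψ.measurable i).comp measurable_fst).mul
      ((measurable_copy hg n hψ.measurable).comp (measurable_fst.prodMk
        (measurable_fst.comp measurable_snd)))
  -- Only the first of the two independent copies enters the integrand; the second integrates to
  -- `1`.
  have hE : ∫ w, ψ (looScore g n w i - newScore g n w) * copyMean μ g ψ n w ∂pairLaw μ n
      = ∫ v, ψ (looScore g n v.1 i - newScore g n v.1) *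
        ψ (newScore g n (v.1.1, v.2.1) - newScore g n v.1)
          ∂(pairLaw μ n).prod (μ.prod μ) := by
    refine Eq.trans ?_ (integral_prod _ ?_).symm
    · refine integral_congr_ae (ae_of_all _ fun w => ?_)
      simp only
      rw [integral_const_mul]
      have := integral_prod_mul (μ := μ) (ν := μ)
        (fun z => ψ (newScore g n (w.1, z) - newScore g n w)) (fun _ => (1 : ℝ))
      simp only [mul_one, integral_const, probReal_univ, smul_eq_mul] at this
      rw [this, copyMean]
    · refine integrable_of_abs_le_one hm fun v => ?_
      rw [abs_mul]
      exact mul_le_one₀ (hψ.abs_le_one _) (abs_nonneg _) (hψ.abs_le_one _)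
  rw [hE, ← integral_comp_of_measurePreserving (measurePreserving_trainNew_two μ n) hm]
  have e (ω : ℕ → Z) : newScore g n (trainNew n ω)
      = seqScore g (n + 1) (Finset.range (n + 1)) ω := newScore_trainNew hs n (n + 1) ω
  simp only [looScore_trainNew hs, e, newScore_trainNew hs]
  have hi := i.2
  have hD : ((Finset.range (n + 1)).erase i).card = n := by
    rw [Finset.card_erase_of_mem (Finset.mem_range.2 hi), Finset.card_range]; simp
  have := abs_integral_sub_pairMoment_le μ hg hψ (D := (Finset.range (n + 1)).erase i) (a := i)
    (b := n + 2) (c := n + 1) (by simp) (by simp) (by simp) (by omega) (by omega) (by omega)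
    (s₁ := (Finset.range (n + 1)).erase i) (r₁ := 0) (by simp [tdist])
    (integral_tdist_new_erase μ hg hs n hi (by omega))
    (integral_tdist_new_erase μ hg hs n hi (by omega))
  rw [hD] at this
  refine this.trans (le_of_eq ?_)
  ring

/-- The square of a conditional mean is a conditional mean of a product over two independent copies.
One training point is deleted only to bring the data set down to size `n`, at cost `1 + 1 + 2 * 1`.
-/
lemma abs_integral_copyMean_sq_sub_le (n : ℕ) :
    |∫ w, copyMean μ g ψ n w * copyMean μ g ψ n w ∂pairLaw μ n - pairMoment μ g ψ n|
      ≤ L * (4 * instability μ g n) := by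
  have hm : Measurable fun v : ((Fin (n + 1) → Z) × Z) × (Z × Z) =>
      ψ (newScore g n (v.1.1, v.2.1) - newScore g n v.1) *
        ψ (newScore g n (v.1.1, v.2.2) - newScore g n v.1) :=
    ((measurable_copy hg n hψ.measurable).comp (measurable_fst.prodMk
        (measurable_fst.comp measurable_snd))).mul
      ((measurable_copy hg n hψ.measurable).comp (measurable_fst.prodMk
        (measurable_snd.comp measurable_snd)))
  have hE : ∫ w, copyMean μ g ψ n w * copyMean μ g ψ n w ∂pairLaw μ n
      = ∫ v, ψ (newScore g n (v.1.1, v.2.1) - newScore g n v.1) *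
        ψ (newScore g n (v.1.1, v.2.2) - newScore g n v.1)
          ∂(pairLaw μ n).prod (μ.prod μ) := by
    refine Eq.trans ?_ (integral_prod _ ?_).symm
    · refine integral_congr_ae (ae_of_all _ fun w => ?_)
      exact (integral_prod_mul (μ := μ) (ν := μ)
        (fun z => ψ (newScore g n (w.1, z) - newScore g n w))
        (fun z => ψ (newScore g n (w.1, z) - newScore g n w))).symm
    · refine integrable_of_abs_le_one hm fun v => ?_
      rw [abs_mul]
      exact mul_le_one₀ (hψ.abs_le_one _) (abs_nonneg _) (hψ.abs_le_one _)
  rw [hE, ← integral_comp_of_measurePreserving (measurePreserving_trainNew_two μ n) hm]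
  have e (ω : ℕ → Z) : newScore g n (trainNew n ω)
      = seqScore g (n + 1) (Finset.range (n + 1)) ω := newScore_trainNew hs n (n + 1) ω
  simp only [e, newScore_trainNew hs]
  have hD : ((Finset.range (n + 1)).erase 0).card = n := by
    rw [Finset.card_erase_of_mem (by simp), Finset.card_range]; simp
  have := abs_integral_sub_pairMoment_le μ hg hψ (D := (Finset.range (n + 1)).erase 0) (a := n + 2)
    (b := n + 3) (c := n + 1) (by simp) (by simp) (by simp) (by omega) (by omega) (by omega)
    (integral_tdist_new_erase μ hg hs n n.succ_pos (by omega))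
    (integral_tdist_new_erase μ hg hs n n.succ_pos (by omega))
    (integral_tdist_new_erase μ hg hs n n.succ_pos (by omega))
  rw [hD] at this
  refine this.trans (le_of_eq ?_)
  ring

/-- The average of the leave-one-out comparisons is close to its conditional mean. -/
lemma integral_average_sub_copyMean_sq_le (n : ℕ) :
    ∫ w, ((∑ i, ψ (looScore g n w i - newScore g n w)) / (n + 1 : ℝ) - copyMean μ g ψ n w) ^ 2
      ∂pairLaw μ n ≤ 1 / (n + 1 : ℝ) + 20 * L * instability μ g n := by
  set A : Fin (n + 1) → (Fin (n + 1) → Z) × Z → ℝ :=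
    fun i w => ψ (looScore g n w i - newScore g n w) with hA
  set h := copyMean μ g ψ n with hh
  set m := pairMoment μ g ψ n
  set τ := instability μ g n
  have hτ : 0 ≤ τ := integral_nonneg fun _ => tdist_nonneg _ _
  have hL : 0 ≤ L := zero_le_one.trans hψ.one_le
  have hn : (0 : ℝ) < n + 1 := by positivity
  have hAm : ∀ i, Measurable (A i) := measurable_loo hg n hψ.measurable
  have hhm : Measurable h := measurable_copyMean μ hg n hψ.measurable
  have hhb : ∀ w, |h w| ≤ 1 := fun w => by
    have := copyMean_mem μ hg n hψ w
    exact abs_le.2 ⟨by linarith, this.2⟩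
  have hAb : ∀ i w, |A i w| ≤ 1 := fun i w => hψ.abs_le_one _
  have hint : ∀ {f f' : (Fin (n + 1) → Z) × Z → ℝ}, Measurable f → Measurable f' →
      (∀ w, |f w| ≤ 1) → (∀ w, |f' w| ≤ 1) → Integrable (fun w => f w * f' w) (pairLaw μ n) :=
    fun hf hf' h1 h2 => integrable_of_abs_le_one (hf.mul hf') fun w => by
      rw [abs_mul]; exact mul_le_one₀ (h1 w) (abs_nonneg _) (h2 w)
  have hdb : ∀ i w, |A i w - h w| ≤ 1 := fun i w => by
    have := copyMean_mem μ hg n hψ w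
    have h1 := hψ.nonneg (looScore g n w i - newScore g n w)
    have h2 := hψ.le_one (looScore g n w i - newScore g n w)
    simp only [hA, hh]
    exact abs_le.2 ⟨by linarith, by linarith⟩
  have hdint : ∀ i j, Integrable (fun w => (A i w - h w) * (A j w - h w)) (pairLaw μ n) :=
    fun i j => hint ((hAm i).sub hhm) ((hAm j).sub hhm) (hdb i) (hdb j)
  have hsq : ∀ w, ((∑ i, A i w) / (n + 1 : ℝ) - h w) ^ 2
      = (∑ i, ∑ j, (A i w - h w) * (A j w - h w)) / (n + 1 : ℝ) ^ 2 := fun w => by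
    rw [← Finset.sum_mul_sum, Finset.sum_sub_distrib, Finset.sum_const, Finset.card_univ,
      Fintype.card_fin, nsmul_eq_mul]
    push_cast
    field_simp
  -- The four terms of the expanded product all approximate the same `pairMoment`, which cancels;
  -- the errors add up to `10 + 4 + 3 + 3 = 20`.
  have hoff : ∀ i j, i ≠ j →
      ∫ w, (A i w - h w) * (A j w - h w) ∂pairLaw μ n ≤ 20 * L * τ := fun i j hij => by
    have e1 : ∀ w, (A i w - h w) * (A j w - h w)
        = (A i w * A j w + h w * h w) - (A i w * h w + A j w * h w) := fun w => by ring
    have iAA := hint (hAm i) (hAm j) (hAb i) (hAb j)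
    have ihh := hint hhm hhm hhb hhb
    have iAh := fun i => hint (hAm i) hhm (hAb i) hhb
    have i1 : Integrable (fun w => A i w * A j w + h w * h w) (pairLaw μ n) := iAA.add ihh
    have i2 : Integrable (fun w => A i w * h w + A j w * h w) (pairLaw μ n) :=
      (iAh i).add (iAh j)
    simp only [e1]
    rw [integral_sub i1 i2, integral_add iAA ihh, integral_add (iAh i) (iAh j)]
    have b1 := (abs_le.1 (abs_integral_loo_mul_loo_sub_le μ hg hs hψ n hij)).2
    have b2 := (abs_le.1 (abs_integral_loo_mul_copyMean_sub_le μ hg hs hψ n i)).1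
    have b3 := (abs_le.1 (abs_integral_loo_mul_copyMean_sub_le μ hg hs hψ n j)).1
    have b4 := (abs_le.1 (abs_integral_copyMean_sq_sub_le μ hg hs hψ n)).2
    simp only [hA]
    linarith
  have hdiag : ∀ i, ∫ w, (A i w - h w) * (A i w - h w) ∂pairLaw μ n ≤ 1 := fun i => by
    calc _ ≤ ∫ _, (1 : ℝ) ∂pairLaw μ n := by
          refine integral_mono (hdint i i) (integrable_const _) fun w => ?_
          have := hdb i w
          simp only
          rw [← abs_mul_abs_self]
          exact mul_le_one₀ this (abs_nonneg _) this
      _ = 1 := by simp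
  have hall : ∀ i j, ∫ w, (A i w - h w) * (A j w - h w) ∂pairLaw μ n
      ≤ (if i = j then 1 else 0) + 20 * L * τ := fun i j => by
    have h0 : 0 ≤ 20 * L * τ := by positivity
    split_ifs with hij
    · subst hij; linarith [hdiag i]
    · linarith [hoff i j hij]
  refine (integral_congr_ae (ae_of_all _ hsq)).trans_le ?_
  rw [integral_div, integral_finsetSum _ fun i _ => integrable_finsetSum _ fun j _ => hdint i j]
  rw [Finset.sum_congr rfl fun i _ => integral_finsetSum _ fun j _ => hdint i j]
  calc _ ≤ (∑ i : Fin (n + 1), ∑ j : Fin (n + 1), ((if i = j then 1 else 0) + 20 * L * τ))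
        / (n + 1 : ℝ) ^ 2 := by
        gcongr with i _ j _
        exact hall i j
    _ = 1 / (n + 1 : ℝ) + 20 * L * τ := by
        simp [Finset.sum_add_distrib]
        field_simp

end JointMoments

/-! ### Perturbed leave-one-out comparisons -/

section LeaveOneOut

variable {Z : Type*} [MeasurableSpace Z] (μ : Measure Z) [IsProbabilityMeasure μ]
  {g : ∀ m : ℕ, Z → (Fin m → Z) → ℝ}

lemma integral_tdist_new_removeNth
    (hg : ∀ m, Measurable fun w : Z × (Fin m → Z) => g m w.1 w.2)
    (hs : ∀ m z T (π : Equiv.Perm (Fin m)), g m z (fun j => T (π j)) = g m z T)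
    (n : ℕ) (i : Fin (n + 1)) :
    ∫ w, tdist (g (n + 1) w.2 w.1) (g n w.2 (i.removeNth w.1)) ∂pairLaw μ n
      ≤ instability μ g n := by
  have hm : Measurable fun w : (Fin (n + 1) → Z) × Z =>
      tdist (g (n + 1) w.2 w.1) (g n w.2 (i.removeNth w.1)) :=
    measurable_tdist (measurable_score_comp hg measurable_snd measurable_fst)
      (measurable_score_comp hg measurable_snd ((measurable_removeNth i).comp measurable_fst))
  rw [← integral_comp_of_measurePreserving (measurePreserving_trainNew μ n) hm]
  have e1 (ω : ℕ → Z) : g (n + 1) (trainNew n ω).2 (trainNew n ω).1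
      = seqScore g (n + 1) (Finset.range (n + 1)) ω := newScore_trainNew hs n (n + 1) ω
  have e2 (ω : ℕ → Z) : g n (trainNew n ω).2 (i.removeNth (trainNew n ω).1)
      = seqScore g (n + 1) ((Finset.range (n + 1)).erase i) ω :=
    score_removeNth_trainNew hs n (n + 1) i ω
  simp only [e1, e2]
  exact integral_tdist_new_erase μ hg hs n i.2 (by omega)

lemma removeNth_castSucc_snoc {Z : Type*} {n : ℕ} (T : Fin (n + 1) → Z) (z : Z)
    (i : Fin (n + 1)) :
    i.castSucc.removeNth (Fin.snoc T z : Fin (n + 2) → Z)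
      = (Fin.snoc (i.removeNth T) z : Fin (n + 1) → Z) := by
  ext j
  induction j using Fin.lastCases with
  | last => rw [Fin.removeNth_apply, Fin.succAbove_ne_last_last (Fin.castSucc_ne_last i)]; simp
  | cast j =>
    rw [Fin.removeNth_apply, Fin.castSucc_succAbove_castSucc, Fin.snoc_castSucc, Fin.snoc_castSucc,
      Fin.removeNth_apply]

lemma measurable_snoc {n : ℕ} :
    Measurable fun w : (Fin n → Z) × Z => (Fin.snoc w.1 w.2 : Fin (n + 1) → Z) := by
  refine measurable_pi_lambda _ fun j => ?_
  induction j using Fin.lastCases with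
  | last => simpa using measurable_snd
  | cast j => simp only [Fin.snoc_castSucc]; fun_prop

/-- The score of a data point with respect to the other data points and the new point. -/
def augmentedScore (g : ∀ m : ℕ, Z → (Fin m → Z) → ℝ) (n : ℕ) (w : (Fin (n + 1) → Z) × Z)
    (i : Fin (n + 1)) : ℝ :=
  g (n + 1) (w.1 i) (i.castSucc.removeNth (Fin.snoc w.1 w.2 : Fin (n + 2) → Z))

lemma measurable_augmentedScore
    (hg : ∀ m, Measurable fun w : Z × (Fin m → Z) => g m w.1 w.2) (n : ℕ) (i : Fin (n + 1)) :
    Measurable fun w => augmentedScore g n w i :=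
  measurable_score_comp hg (by fun_prop) ((measurable_removeNth _).comp measurable_snoc)

/-- The two data sets differ exactly by the new point, and neither contains the point `i` being
scored. So this too is a deletion of one point, with `i` in the role of the new point. -/
lemma integral_tdist_augmentedScore
    (hg : ∀ m, Measurable fun w : Z × (Fin m → Z) => g m w.1 w.2)
    (hs : ∀ m z T (π : Equiv.Perm (Fin m)), g m z (fun j => T (π j)) = g m z T)
    (n : ℕ) (i : Fin (n + 1)) :
    ∫ w, tdist (augmentedScore g n w i) (looScore g n w i) ∂pairLaw μ n
      ≤ instability μ g n := by
  have hm : Measurable fun w : (Fin (n + 1) → Z) × Z =>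
      tdist (augmentedScore g n w i) (looScore g n w i) :=
    measurable_tdist (measurable_augmentedScore hg n i) (measurable_looScore hg n i)
  rw [← integral_comp_of_measurePreserving (measurePreserving_trainNew μ n) hm]
  have hi := i.2
  set s := (Finset.range (n + 1)).erase i with hsdef
  have hns : n + 1 ∉ s := by simp [hsdef]
  have e (ω : ℕ → Z) : augmentedScore g n (trainNew n ω) i
      = seqScore g i (insert (n + 1) s) ω := by
    rw [augmentedScore, removeNth_castSucc_snoc]
    let e : Fin n → ℕ := fun j => ((i.succAbove j : Fin (n + 1)) : ℕ)
    have he : Function.Injective e := Fin.val_injective.comp Fin.succAbove_right_injective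
    rw [← score_eq_seqScore hs (e := (Fin.snoc e (n + 1) : Fin (n + 1) → ℕ))
      (Fin.snoc_injective_iff.2 ⟨he, ?_⟩) (s := insert (n + 1) s)]
    · congr 1
      ext j
      induction j using Fin.lastCases with
      | last => simp [trainNew]
      | cast j => simp [trainNew, e, Fin.removeNth_apply]
    · intro x
      rw [Finset.mem_insert, hsdef, Finset.mem_erase, Finset.mem_range]
      constructor
      · rintro (rfl | ⟨h1, h2⟩)
        · exact ⟨Fin.last _, by simp⟩
        · obtain ⟨j, hj⟩ := Fin.exists_succAbove_eq (x := (⟨x, h2⟩ : Fin (n + 1))) (y := i)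
            (fun h => h1 (by rw [← h]))
          exact ⟨j.castSucc, by simp [e, hj]⟩
      · rintro ⟨j, rfl⟩
        induction j using Fin.lastCases with
        | last => simp
        | cast j =>
          right
          simp only [Fin.snoc_castSucc, e]
          exact ⟨fun h => Fin.succAbove_ne i j (Fin.ext h), (i.succAbove j).2⟩
    · rintro ⟨j, hj⟩
      have : ((i.succAbove j : Fin (n + 1)) : ℕ) = n + 1 := hj
      have := (i.succAbove j).2
      omega
  simp only [e, looScore_trainNew hs]
  have := integral_tdist_insert μ hg hs (s := s) (a := i) (b := n + 1) hns (by
    simp [hsdef]; omega)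
  rw [this, hsdef, Finset.card_erase_of_mem (Finset.mem_range.2 hi), Finset.card_range]
  simp

/-- The distribution of averages over arrays that are close to the leave-one-out comparisons. -/
lemma measureReal_average_sub_copyMean_le
    (hg : ∀ m, Measurable fun w : Z × (Fin m → Z) => g m w.1 w.2)
    (hs : ∀ m z T (π : Equiv.Perm (Fin m)), g m z (fun j => T (π j)) = g m z T)
    {ψ : ℝ → ℝ} {L : ℝ} (hψ : IsUnitLipschitz ψ L) (n : ℕ)
    {u : (Fin (n + 1) → Z) × Z → Fin (n + 1) → ℝ} (hu : ∀ i, Measurable fun w => u w i)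
    {r : ℝ} (hr : ∀ i, ∫ w, tdist (u w i) (looScore g n w i - newScore g n w) ∂pairLaw μ n ≤ r)
    {κ : ℝ} (hκ : 0 < κ) :
    (pairLaw μ n).real {w | κ ≤ |(∑ i, ψ (u w i)) / (n + 1 : ℝ) - copyMean μ g ψ n w|}
      ≤ 2 * L / κ * r + 4 / κ ^ 2 * (1 / (n + 1 : ℝ) + 20 * L * instability μ g n) := by
  have hL : 0 ≤ L := zero_le_one.trans hψ.one_le
  have hn : (0 : ℝ) < n + 1 := by positivity
  have hv : ∀ i, Measurable fun w => looScore g n w i - newScore g n w :=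
    fun i => (measurable_looScore hg n i).sub (measurable_newScore hg n)
  set D : (Fin (n + 1) → Z) × Z → ℝ := fun w =>
    (∑ i, tdist (u w i) (looScore g n w i - newScore g n w)) / (n + 1 : ℝ) with hD
  set V : (Fin (n + 1) → Z) × Z → ℝ := fun w =>
    (∑ i, ψ (looScore g n w i - newScore g n w)) / (n + 1 : ℝ) - copyMean μ g ψ n w with hV
  have hD0 : ∀ w, 0 ≤ D w := fun w =>
    div_nonneg (Finset.sum_nonneg fun _ _ => tdist_nonneg _ _) hn.le
  have hDi : Integrable D (pairLaw μ n) :=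
    (integrable_finsetSum _ fun i _ => integrable_tdist (hu i) (hv i)).div_const _
  have hVm : Measurable V :=
    ((Finset.measurable_sum _ fun i _ => measurable_loo hg n hψ.measurable i).div_const _).sub
      (measurable_copyMean μ hg n hψ.measurable)
  have hVb : ∀ w, |V w| ≤ 1 := fun w => by
    have h1 := copyMean_mem μ hg n hψ w
    have h2 : 0 ≤ (∑ i, ψ (looScore g n w i - newScore g n w)) / (n + 1 : ℝ) :=
      div_nonneg (Finset.sum_nonneg fun _ _ => hψ.nonneg _) hn.le
    have h3 : (∑ i, ψ (looScore g n w i - newScore g n w)) / (n + 1 : ℝ) ≤ 1 := by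
      rw [div_le_one hn]
      calc _ ≤ ∑ _i : Fin (n + 1), (1 : ℝ) := Finset.sum_le_sum fun _ _ => hψ.le_one _
        _ = n + 1 := by simp
    exact abs_le.2 ⟨by simp only [hV]; linarith, by simp only [hV]; linarith⟩
  have hVi : Integrable (fun w => V w ^ 2) (pairLaw μ n) :=
    integrable_of_abs_le_one (hVm.pow_const 2) fun w => by
      rw [abs_pow]; exact pow_le_one₀ (abs_nonneg _) (hVb w)
  have hDr : ∫ w, D w ∂pairLaw μ n ≤ r := by
    simp only [hD]
    rw [integral_div, integral_finsetSum _ fun i _ => integrable_tdist (hu i) (hv i),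
      div_le_iff₀ hn]
    calc _ ≤ ∑ _i : Fin (n + 1), r := Finset.sum_le_sum fun i _ => hr i
      _ = r * (n + 1) := by simp [mul_comm]
  have hVr := integral_average_sub_copyMean_sq_le μ hg hs hψ n
  -- One application of Markov's inequality suffices. On the event either `L * D` or `|V|` is at
  -- least `κ / 2`, and the weights are such that the corresponding summand is then at least `1`.
  have hfi : Integrable (fun w => 2 * L / κ * D w + 4 / κ ^ 2 * V w ^ 2) (pairLaw μ n) :=
    (hDi.const_mul _).add (hVi.const_mul _)
  have hf0 : ∀ w, 0 ≤ 2 * L / κ * D w + 4 / κ ^ 2 * V w ^ 2 := fun w => by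
    have := hD0 w
    positivity
  have hmarkov := mul_meas_ge_le_integral_of_nonneg (ae_of_all _ hf0) hfi 1
  rw [one_mul] at hmarkov
  calc _ ≤ (pairLaw μ n).real {w | 1 ≤ 2 * L / κ * D w + 4 / κ ^ 2 * V w ^ 2} := by
        refine measureReal_mono fun w hw => ?_
        have hw' : κ ≤ |(∑ i, ψ (u w i)) / (n + 1 : ℝ) - copyMean μ g ψ n w| := hw
        have h1 : |(∑ i, ψ (u w i)) / (n + 1 : ℝ) - copyMean μ g ψ n w| ≤ L * D w + |V w| := by
          have : (∑ i, ψ (u w i)) / (n + 1 : ℝ) - copyMean μ g ψ n w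
              = (∑ i, (ψ (u w i) - ψ (looScore g n w i - newScore g n w))) / (n + 1 : ℝ)
                + V w := by
            simp only [hV, Finset.sum_sub_distrib]; ring
          rw [this]
          refine (abs_add_le _ _).trans (add_le_add ?_ le_rfl)
          rw [abs_div, abs_of_pos hn, hD, ← mul_div_assoc, Finset.mul_sum]
          gcongr
          exact (Finset.abs_sum_le_sum_abs _ _).trans
            (Finset.sum_le_sum fun i _ => hψ.abs_sub_le _ _)
        have hD0w := hD0 w
        show 1 ≤ 2 * L / κ * D w + 4 / κ ^ 2 * V w ^ 2
        rcases le_total (κ / 2) (L * D w) with h | h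
        · have e1 : 2 * L / κ * D w = (L * D w) / (κ / 2) := by field_simp
          have : 1 ≤ 2 * L / κ * D w := by rw [e1, one_le_div (by positivity)]; exact h
          have : 0 ≤ 4 / κ ^ 2 * V w ^ 2 := by positivity
          linarith
        · have h2 : κ / 2 ≤ |V w| := by linarith
          have e1 : 4 / κ ^ 2 * V w ^ 2 = (|V w| / (κ / 2)) ^ 2 := by
            rw [div_pow, sq_abs]; field_simp; ring
          have : 1 ≤ 4 / κ ^ 2 * V w ^ 2 := by
            rw [e1]
            exact one_le_pow₀ ((one_le_div (by positivity)).2 h2)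
          have : 0 ≤ 2 * L / κ * D w := by positivity
          linarith
    _ ≤ _ := hmarkov
    _ = 2 * L / κ * ∫ w, D w ∂pairLaw μ n + 4 / κ ^ 2 * ∫ w, V w ^ 2 ∂pairLaw μ n := by
        rw [integral_add (hDi.const_mul _) (hVi.const_mul _), integral_const_mul,
          integral_const_mul]
    _ ≤ _ := by gcongr

end LeaveOneOut

/-! ### Ramps -/

/-- The function that is `0` on `(-∞, a]`, is `1` on `[a + ε, ∞)`, and is linear in between. -/
def ramp (a ε u : ℝ) : ℝ := max 0 (min 1 ((u - a) / ε))

lemma isUnitLipschitz_ramp (a : ℝ) {ε : ℝ} (hε : 0 < ε) :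
    IsUnitLipschitz (ramp a ε) (max 1 (1 / ε)) where
  nonneg _ := le_max_left _ _
  le_one _ := max_le zero_le_one (min_le_left _ _)
  one_le := le_max_left _ _
  lipschitz u v := by
    unfold ramp
    refine (abs_max_sub_max_le_max _ _ _ _).trans ?_
    rw [sub_self, abs_zero, max_eq_right (abs_nonneg _)]
    refine (abs_min_sub_min_le_max _ _ _ _).trans ?_
    rw [sub_self, abs_zero, max_eq_right (abs_nonneg _), ← sub_div, sub_sub_sub_cancel_right,
      abs_div, abs_of_pos hε, div_eq_mul_one_div, mul_comm]
    exact mul_le_mul_of_nonneg_right (le_max_right _ _) (abs_nonneg _)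

/-- Together with `indicator_le_ramp`, this replaces the discontinuous counting of comparisons by a
Lipschitz average, at the price of moving a threshold by `ε`. -/
lemma ramp_le_indicator (a : ℝ) {ε : ℝ} (hε : 0 < ε) (u : ℝ) :
    ramp a ε u ≤ if a ≤ u then 1 else 0 := by
  unfold ramp
  split_ifs with h
  · exact max_le zero_le_one (min_le_left _ _)
  · exact max_le le_rfl ((min_le_right _ _).trans
      (div_nonpos_of_nonpos_of_nonneg (by linarith) hε.le))

lemma indicator_le_ramp (a : ℝ) {ε : ℝ} (hε : 0 < ε) (u : ℝ) :
    (if a + ε ≤ u then (1 : ℝ) else 0) ≤ ramp a ε u := by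
  unfold ramp
  split_ifs with h
  · exact le_max_of_le_right (le_min le_rfl ((one_le_div hε).2 (by linarith)))
  · exact le_max_left _ _

/-! ### Survival functions -/

section Survival

variable (ν : Measure ℝ) [IsProbabilityMeasure ν]

/-- A survival function evaluated at its own random variable is stochastically larger than
uniform. -/
lemma measureReal_survival_le {β : ℝ} (hβ : 0 ≤ β) :
    ν.real {r | ν.real (Ici r) ≤ β} ≤ β := by
  have hord : {r | ν.real (Ici r) ≤ β}.OrdConnected :=
    ⟨fun x hx y _ z hz => (measureReal_mono (Ici_subset_Ici.2 hz.1)).trans hx⟩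
  refine ENNReal.toReal_le_of_le_ofReal hβ ?_
  -- The set is an upper interval that need not contain its infimum. A compact subset does have a
  -- least element, which satisfies the defining inequality and bounds the measure of that subset.
  rw [hord.measurableSet.measure_eq_iSup_isCompact]
  refine iSup₂_le fun K hK => iSup_le fun hKc => ?_
  rcases K.eq_empty_or_nonempty with rfl | hne
  · simp
  obtain ⟨r, hr⟩ := hKc.exists_isLeast hne
  calc ν K ≤ ν (Ici r) := measure_mono fun x hx => hr.2 hx
    _ = ENNReal.ofReal (ν.real (Ici r)) := (ofReal_measureReal).symm
    _ ≤ _ := ENNReal.ofReal_le_ofReal (hK hr.1)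

/-- Without atoms, a survival function evaluated at its own random variable is stochastically
smaller than uniform. -/
lemma measureReal_lt_survival_le [NullSingletonClass ν] {β : ℝ} (hβ : β ≤ 1) :
    ν.real {r | β < ν.real (Ici r)} ≤ 1 - β := by
  have hord : {r | β < ν.real (Ici r)}.OrdConnected :=
    ⟨fun x _ y hy z hz => lt_of_lt_of_le hy (measureReal_mono (Ici_subset_Ici.2 hz.2))⟩
  refine ENNReal.toReal_le_of_le_ofReal (by linarith) ?_
  rw [hord.measurableSet.measure_eq_iSup_isCompact]
  refine iSup₂_le fun K hK => iSup_le fun hKc => ?_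
  rcases K.eq_empty_or_nonempty with rfl | hne
  · simp
  obtain ⟨r, hr⟩ := hKc.exists_isGreatest hne
  have h1 : β < ν.real (Ici r) := hK hr.1
  -- The absence of atoms enters here, to replace `Ioi r` by `Ici r`.
  have h2 : ν.real (Iic r) = 1 - ν.real (Ici r) := by
    rw [← measureReal_congr (Ioi_ae_eq_Ici (a := r) (μ := ν)), ← compl_Iic,
      probReal_compl_eq_one_sub measurableSet_Iic]
    ring
  calc ν K ≤ ν (Iic r) := measure_mono fun x hx => hr.2 hx
    _ = ENNReal.ofReal (ν.real (Iic r)) := (ofReal_measureReal).symm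
    _ ≤ _ := ENNReal.ofReal_le_ofReal (by linarith)

end Survival

/-- A joint event of small probability has small conditional probability. -/
lemma measure_le_section_le {α β : Type*} [MeasurableSpace α] [MeasurableSpace β] (μ : Measure α)
    (ν : Measure β) [IsProbabilityMeasure μ] [IsProbabilityMeasure ν] (B : Set (α × β)) {η : ℝ}
    (hη : 0 < η) :
    μ {a | η ≤ ν.real (Prod.mk a ⁻¹' B)} ≤ (μ.prod ν) B / ENNReal.ofReal η := by
  -- A measurable hull is needed since `B` is arbitrary; in the applications it is a union over all
  -- levels `α`.
  have hm := measurableSet_toMeasurable (μ.prod ν) B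
  rw [← measure_toMeasurable B, Measure.prod_apply hm]
  refine (measure_mono fun a ha => ?_).trans
    (meas_ge_le_lintegral_div (measurable_measure_prodMk_left hm).aemeasurable
      (by simpa using hη) ENNReal.ofReal_ne_top)
  have ha' : η ≤ ν.real (Prod.mk a ⁻¹' B) := ha
  show ENNReal.ofReal η ≤ ν (Prod.mk a ⁻¹' toMeasurable (μ.prod ν) B)
  calc ENNReal.ofReal η ≤ ENNReal.ofReal (ν.real (Prod.mk a ⁻¹' B)) :=
        ENNReal.ofReal_le_ofReal ha'
    _ = ν (Prod.mk a ⁻¹' B) := ofReal_measureReal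
    _ ≤ _ := measure_mono (preimage_mono (subset_toMeasurable _ _))

/-- Convergence to zero in probability implies convergence to zero of the means, for functions
bounded by `1`. -/
lemma tendsto_lintegral_of_tendsto_measure {Ω : ℕ → Type*} [∀ n, MeasurableSpace (Ω n)]
    {μ : ∀ n, Measure (Ω n)} [∀ n, IsProbabilityMeasure (μ n)] {X : ∀ n, Ω n → ℝ}
    (hX : ∀ n ω, X n ω ≤ 1)
    (h : ∀ η : ℝ, 0 < η → Tendsto (fun n => μ n {ω | η ≤ X n ω}) atTop (𝓝 0)) :
    Tendsto (fun n => ∫⁻ ω, ENNReal.ofReal (X n ω) ∂μ n) atTop (𝓝 0) := by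
  have key : ∀ (η : ℝ) n, ∫⁻ ω, ENNReal.ofReal (X n ω) ∂μ n
      ≤ ENNReal.ofReal η + μ n {ω | η ≤ X n ω} := fun η n => by
    -- Again a hull, because `X n` will be a supremum over uncountably many levels.
    set B := toMeasurable (μ n) {ω | η ≤ X n ω} with hB
    have hBm : MeasurableSet B := measurableSet_toMeasurable _ _
    calc _ ≤ ∫⁻ ω, (ENNReal.ofReal η + B.indicator 1 ω) ∂μ n := by
          refine lintegral_mono fun ω => ?_
          by_cases hω : η ≤ X n ω
          · have : ω ∈ B := subset_toMeasurable _ _ hω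
            simp only [indicator_of_mem this, Pi.one_apply]
            refine le_add_left ?_
            simpa using ENNReal.ofReal_le_ofReal (hX n ω)
          · exact le_add_right (ENNReal.ofReal_le_ofReal (not_le.1 hω).le)
      _ = ENNReal.ofReal η + μ n B := by
          rw [lintegral_add_left measurable_const, lintegral_const, measure_univ, mul_one,
            lintegral_indicator_one hBm]
      _ = _ := by rw [hB, measure_toMeasurable]
  rw [ENNReal.tendsto_nhds_zero]
  intro ε hε
  obtain ⟨η, hη, hηε⟩ : ∃ η : ℝ, 0 < η ∧ ENNReal.ofReal η ≤ ε / 2 := by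
    rcases eq_or_ne ε ⊤ with rfl | hε'
    · exact ⟨1, one_pos, by simp [ENNReal.top_div]⟩
    · refine ⟨(ε / 2).toReal, ENNReal.toReal_pos (by simpa using hε.ne') ?_,
        ENNReal.ofReal_toReal_le⟩
      exact (ENNReal.div_lt_top hε' (by norm_num)).ne
  filter_upwards [(ENNReal.tendsto_nhds_zero.1 (h η hη)) (ε / 2) (ENNReal.half_pos hε.ne')]
    with n hn
  calc _ ≤ _ := key η n
    _ ≤ ε / 2 + ε / 2 := add_le_add hηε hn
    _ = ε := ENNReal.add_halves ε

/-! ### Methods that follow the conditional distribution of the score -/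

section Follows

variable {Y : ℕ → Set ℝ} {p : ℕ → ℕ} (P : ∀ n, Measure (Obs (Y n) (p n)))
  (C : Score Y p) (M : Method Y p)

/-- The conditional probability, given the training data, that the score of a new pair is at least
`r`. -/
def survival (n : ℕ) (T : Fin n → Obs (Y n) (p n)) (r : ℝ) : ℝ := (P n).real {z | r ≤ C n n z T}

/-- The event that the `δ`-inflated set misses the response at a level which is smaller by `κ` than
the conditional survival function at the score minus `δ` plus `ε`. -/
def tooSmall (n : ℕ) (δ ε κ : ℝ) : Set ((Fin n → Obs (Y n) (p n)) × Obs (Y n) (p n)) :=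
  {w | ∃ α ∈ Icc (0 : ℝ) 1, w.2.1 ∉ M n α δ w.1 w.2.2 ∧
    α + κ < survival P C n w.1 (C n n w.2 w.1 - δ + ε)}

/-- The event that the set covers the response at a level which is larger by `κ` than the
conditional survival function at the score minus `ε`. -/
def tooLarge (n : ℕ) (ε κ : ℝ) : Set ((Fin n → Obs (Y n) (p n)) × Obs (Y n) (p n)) :=
  {w | ∃ α ∈ Icc (0 : ℝ) 1, w.2.1 ∈ M n α 0 w.1 w.2.2 ∧
    survival P C n w.1 (C n n w.2 w.1 - ε) < α - κ}

/-- A method follows a score if, up to small errors, it covers the new response at exactly the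
levels that are smaller than the conditional survival function at the score of the new pair. -/
structure Follows : Prop where
  tendsto_tooSmall : ∀ δ ε κ : ℝ, 0 ≤ δ → 0 < ε → 0 < κ →
    Tendsto (fun n => jointLaw P n (tooSmall P C M n δ ε κ)) atTop (𝓝 0)
  tendsto_tooLarge : ∀ ε κ : ℝ, 0 < ε → 0 < κ →
    Tendsto (fun n => jointLaw P n (tooLarge P C M n ε κ)) atTop (𝓝 0)

variable {P C M}

lemma measurable_score (hC : ∀ n m : ℕ, Measurable
    (fun w : Obs (Y n) (p n) × (Fin m → Obs (Y n) (p n)) => C n m w.1 w.2)) (n : ℕ)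
    (T : Fin n → Obs (Y n) (p n)) : Measurable fun z => C n n z T :=
  (hC n n).comp measurable_prodMk_right

lemma survival_eq (hC : ∀ n m : ℕ, Measurable
    (fun w : Obs (Y n) (p n) × (Fin m → Obs (Y n) (p n)) => C n m w.1 w.2)) (n : ℕ)
    (T : Fin n → Obs (Y n) (p n)) (r : ℝ) :
    survival P C n T r = ((P n).map fun z => C n n z T).real (Ici r) := by
  rw [map_measureReal_apply (measurable_score hC n T) measurableSet_Ici]
  rfl

variable [∀ n, IsProbabilityMeasure (P n)]

lemma measureReal_survival_score_le (hC : ∀ n m : ℕ, Measurable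
    (fun w : Obs (Y n) (p n) × (Fin m → Obs (Y n) (p n)) => C n m w.1 w.2)) (n : ℕ)
    (T : Fin n → Obs (Y n) (p n)) {β : ℝ} (hβ : 0 ≤ β) :
    (P n).real {z | survival P C n T (C n n z T) ≤ β} ≤ β := by
  have hm := measurable_score hC n T
  have := Measure.isProbabilityMeasure_map (μ := P n) hm.aemeasurable
  have hord : {r | survival P C n T r ≤ β}.OrdConnected :=
    ⟨fun x hx y _ z hz => (measureReal_mono fun z' hz' => hz.1.trans hz').trans hx⟩
  refine le_trans (le_of_eq ?_) (measureReal_survival_le ((P n).map fun z => C n n z T) hβ)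
  simp only [← survival_eq hC]
  rw [map_measureReal_apply hm hord.measurableSet]
  rfl

lemma measureReal_lt_survival_score_le (hC : ∀ n m : ℕ, Measurable
    (fun w : Obs (Y n) (p n) × (Fin m → Obs (Y n) (p n)) => C n m w.1 w.2)) (n : ℕ)
    (T : Fin n → Obs (Y n) (p n)) [NullSingletonClass ((P n).map fun z => C n n z T)] {β : ℝ} (hβ : β ≤ 1) :
    (P n).real {z | β < survival P C n T (C n n z T)} ≤ 1 - β := by
  have hm := measurable_score hC n T
  have := Measure.isProbabilityMeasure_map (μ := P n) hm.aemeasurable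
  have hord : {r | β < survival P C n T r}.OrdConnected :=
    ⟨fun x _ y hy z hz => lt_of_lt_of_le hy (measureReal_mono fun z' hz' => hz.2.trans hz')⟩
  refine le_trans (le_of_eq ?_) (measureReal_lt_survival_le ((P n).map fun z => C n n z T) hβ)
  simp only [← survival_eq hC]
  rw [map_measureReal_apply hm hord.measurableSet]
  rfl

lemma tendsto_measure_section {B : ∀ n, Set ((Fin n → Obs (Y n) (p n)) × Obs (Y n) (p n))}
    (h : Tendsto (fun n => jointLaw P n (B n)) atTop (𝓝 0)) {η : ℝ} (hη : 0 < η) :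
    Tendsto (fun n => trainLaw P n {T | η ≤ (P n).real (Prod.mk T ⁻¹' B n)}) atTop (𝓝 0) := by
  have h' := ENNReal.Tendsto.div_const h (b := ENNReal.ofReal η) (Or.inr (by simpa using hη))
  rw [ENNReal.zero_div] at h'
  exact tendsto_of_tendsto_of_tendsto_of_le_of_le tendsto_const_nhds h' (fun _ => zero_le)
    fun n => measure_le_section_le _ _ _ hη

/-- Outside the exceptional event, a miss at level `α` forces the survival function at the score to
be at most `α + η / 2`, which has conditional probability at most `α + η / 2`. The exceptional event
does not depend on `α`, so the bound is uniform. -/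
lemma Follows.inflatedConservative (h : Follows P C M) (hC : ∀ n m : ℕ, Measurable
    (fun w : Obs (Y n) (p n) × (Fin m → Obs (Y n) (p n)) => C n m w.1 w.2)) :
    InflatedConservative P M := by
  intro δ hδ η hη
  -- Taking `ε = δ` makes the inflation cancel the shift of the score exactly.
  refine tendsto_of_tendsto_of_tendsto_of_le_of_le tendsto_const_nhds
    (tendsto_measure_section (h.tendsto_tooSmall δ δ (η / 2) hδ.le hδ (half_pos hη))
      (half_pos hη)) (fun _ => zero_le) fun n => measure_mono fun T hT => ?_
  set B := tooSmall P C M n δ δ (η / 2)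
  have hT' : η ≤ ⨆ α : Icc (0 : ℝ) 1, (missProb P M n α δ T - (α : ℝ)) := hT
  have : ⨆ α : Icc (0 : ℝ) 1, (missProb P M n α δ T - (α : ℝ))
      ≤ η / 2 + (P n).real (Prod.mk T ⁻¹' B) := by
    have : Nonempty (Icc (0 : ℝ) 1) := ⟨⟨0, by simp⟩⟩
    refine ciSup_le fun ⟨α, hα⟩ => ?_
    have h1 : missProb P M n α δ T ≤ (P n).real (Prod.mk T ⁻¹' B) +
        (P n).real {z | survival P C n T (C n n z T) ≤ α + η / 2} := by
      refine le_trans (measureReal_mono fun z hz => ?_) (measureReal_union_le _ _)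
      by_cases hz' : survival P C n T (C n n z T) ≤ α + η / 2
      · exact Or.inr hz'
      · refine Or.inl ⟨α, hα, hz, ?_⟩
        rw [sub_add_cancel]
        exact not_le.1 hz'
    have h2 := measureReal_survival_score_le (P := P) hC n T (β := α + η / 2)
      (by have := hα.1; positivity)
    show missProb P M n α δ T - α ≤ _
    linarith
  show η / 2 ≤ (P n).real (Prod.mk T ⁻¹' B)
  linarith

/-- The density bound makes the survival function Lipschitz; in the non-inflated case this takes
over the role of the inflation. -/
lemma survival_sub_le {n : ℕ} {T : Fin n → Obs (Y n) (p n)} (hC : ∀ n m : ℕ, Measurable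
    (fun w : Obs (Y n) (p n) × (Fin m → Obs (Y n) (p n)) => C n m w.1 w.2)) {f : ℝ → ENNReal}
    (hf : (P n).map (fun z => C n n z T) = volume.withDensity f) {K : NNReal}
    (hK : ⨆ s, f s ≤ K) (r : ℝ) {ε : ℝ} (hε : 0 ≤ ε) :
    survival P C n T (r - ε) ≤ survival P C n T r + K * ε := by
  rw [survival_eq hC, survival_eq hC]
  have := Measure.isProbabilityMeasure_map (μ := P n) (measurable_score hC n T).aemeasurable
  set ν := (P n).map fun z => C n n z T
  have h1 : ν.real (Ico (r - ε) r) ≤ K * ε := by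
    refine ENNReal.toReal_le_of_le_ofReal (by positivity) ?_
    rw [hf, withDensity_apply _ measurableSet_Ico]
    calc ∫⁻ s in Ico (r - ε) r, f s ≤ ∫⁻ _ in Ico (r - ε) r, (K : ENNReal) :=
          lintegral_mono fun s => (le_iSup f s).trans hK
      _ = ENNReal.ofReal (K * ε) := by
          rw [setLIntegral_const, Real.volume_Ico, sub_sub_cancel,
            ENNReal.ofReal_mul (NNReal.coe_nonneg K), ENNReal.ofReal_coe_nnreal]
  calc ν.real (Ici (r - ε)) ≤ ν.real (Ico (r - ε) r ∪ Ici r) := by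
        refine measureReal_mono fun x hx => ?_
        rcases lt_or_ge x r with h | h
        · exact Or.inl ⟨hx, h⟩
        · exact Or.inr h
    _ ≤ ν.real (Ico (r - ε) r) + ν.real (Ici r) := measureReal_union_le _ _
    _ ≤ _ := by linarith

lemma abs_missProb_sub_le (hC : ∀ n m : ℕ, Measurable
    (fun w : Obs (Y n) (p n) × (Fin m → Obs (Y n) (p n)) => C n m w.1 w.2)) {n : ℕ}
    {T : Fin n → Obs (Y n) (p n)} {f : ℝ → ENNReal}
    (hf : (P n).map (fun z => C n n z T) = volume.withDensity f) {K : NNReal}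
    (hK : ⨆ s, f s ≤ K) {ε κ : ℝ} (hε : 0 < ε) (hκ : 0 < κ) {α : ℝ} (hα : α ∈ Icc (0 : ℝ) 1) :
    |missProb P M n α 0 T - α| ≤ 2 * κ + K * ε +
      (P n).real (Prod.mk T ⁻¹' tooSmall P C M n 0 ε κ) +
      (P n).real (Prod.mk T ⁻¹' tooLarge P C M n ε κ) := by
  have hnull : NullSingletonClass ((P n).map fun z => C n n z T) := by rw [hf]; infer_instance
  have hKε : 0 ≤ K * ε := by positivity
  have hb1 : 0 ≤ (P n).real (Prod.mk T ⁻¹' tooSmall P C M n 0 ε κ) := measureReal_nonneg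
  have hb2 : 0 ≤ (P n).real (Prod.mk T ⁻¹' tooLarge P C M n ε κ) := measureReal_nonneg
  rw [abs_le]
  constructor
  · have h0 : 1 ≤ missProb P M n α 0 T + (P n).real {z | z.1 ∈ M n α 0 T z.2} := by
      calc (1 : ℝ) = (P n).real univ := by simp
        _ ≤ (P n).real ({z | z.1 ∉ M n α 0 T z.2} ∪ {z | z.1 ∈ M n α 0 T z.2}) :=
            measureReal_mono fun z _ => (em _).symm
        _ ≤ _ := measureReal_union_le _ _
    have h1 : (P n).real {z | z.1 ∈ M n α 0 T z.2} ≤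
        (P n).real (Prod.mk T ⁻¹' tooLarge P C M n ε κ) +
        (P n).real {z | α - 2 * κ - K * ε < survival P C n T (C n n z T)} := by
      refine le_trans (measureReal_mono fun z hz => ?_) (measureReal_union_le _ _)
      -- Otherwise the survival function at the score is at least `α - κ - K * ε`; the second `κ`
      -- only makes the inequality strict.
      by_cases hz' : survival P C n T (C n n z T - ε) < α - κ
      · exact Or.inl ⟨α, hα, hz, hz'⟩
      · refine Or.inr ?_
        have := survival_sub_le hC hf hK (C n n z T) hε.le
        show α - 2 * κ - K * ε < survival P C n T (C n n z T)
        linarith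
    have h2 := measureReal_lt_survival_score_le (P := P) hC n T (β := α - 2 * κ - K * ε)
      (by linarith [hα.2])
    linarith
  · have h1 : missProb P M n α 0 T ≤ (P n).real (Prod.mk T ⁻¹' tooSmall P C M n 0 ε κ) +
        (P n).real {z | survival P C n T (C n n z T) ≤ α + κ + K * ε} := by
      refine le_trans (measureReal_mono fun z hz => ?_) (measureReal_union_le _ _)
      by_cases hz' : survival P C n T (C n n z T - 0 + ε) ≤ α + κ
      · refine Or.inr ?_
        have := survival_sub_le hC hf hK (C n n z T - 0 + ε) hε.le
        rw [sub_zero, add_sub_cancel_right] at this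
        rw [sub_zero] at hz'
        show survival P C n T (C n n z T) ≤ α + κ + K * ε
        linarith
      · exact Or.inl ⟨α, hα, hz, not_le.1 hz'⟩
    have h2 := measureReal_survival_score_le (P := P) hC n T (β := α + κ + K * ε)
      (by have := hα.1; positivity)
    linarith

lemma Follows.nonInflatedValid (h : Follows P C M) (hC : ∀ n m : ℕ, Measurable
    (fun w : Obs (Y n) (p n) × (Fin m → Obs (Y n) (p n)) => C n m w.1 w.2))
    (hcc : ContinuousCase P C) : NonInflatedValid P M := by
  have hne : Nonempty (Icc (0 : ℝ) 1) := ⟨⟨0, by simp⟩⟩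
  refine tendsto_lintegral_of_tendsto_measure (fun n T => ciSup_le fun ⟨α, hα⟩ => ?_)
    fun η hη => ?_
  · have h0 : 0 ≤ missProb P M n α 0 T := measureReal_nonneg
    have h1 : missProb P M n α 0 T ≤ 1 := measureReal_le_one
    exact abs_le.2 ⟨by linarith [hα.2], by linarith [hα.1]⟩
  obtain ⟨f, hf, hb⟩ := hcc
  rw [ENNReal.tendsto_nhds_zero]
  intro ξ hξ
  obtain ⟨K, hK⟩ := hb (ξ / 2) (ENNReal.half_pos hξ.ne')
  have hK1 : (0 : ℝ) < K + 1 := by positivity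
  -- First `K` is fixed, then `ε` and `κ`, so that `2 * κ = η / 4` and `K * ε < η / 4`; the two
  -- exceptional sections stay below `η / 4` each. The summand `1` allows `K = 0`.
  set ε : ℝ := η / (4 * (K + 1)) with hεdef
  have hε : 0 < ε := by positivity
  have hKε : K * ε < η / 4 := by
    have : (K + 1) * ε = η / 4 := by rw [hεdef]; field_simp
    nlinarith
  set κ : ℝ := η / 8 with hκdef
  have hκ : 0 < κ := by positivity
  have t1 := tendsto_measure_section (h.tendsto_tooSmall 0 ε κ le_rfl hε hκ) (η := η / 4)
    (by positivity)
  have t2 := tendsto_measure_section (h.tendsto_tooLarge ε κ hε hκ) (η := η / 4)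
    (by positivity)
  have t3 := t1.add t2
  rw [add_zero] at t3
  filter_upwards [(ENNReal.tendsto_nhds_zero.1 t3) (ξ / 2) (ENNReal.half_pos hξ.ne'),
    eventually_ge_atTop 1] with n hn hn1
  set S := {T | ¬ ((P n).map (fun z => C n n z T) = volume.withDensity (f n T))}
  have hS : trainLaw P n S = 0 := by
    have := hf n hn1
    rw [ae_iff] at this
    refine measure_mono_null ?_ this
    intro T hT hT'
    exact hT hT'.2
  calc _ ≤ trainLaw P n ((S ∪ {T | (K : ENNReal) < ⨆ s, f n T s}) ∪
        ({T | η / 4 ≤ (P n).real (Prod.mk T ⁻¹' tooSmall P C M n 0 ε κ)} ∪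
         {T | η / 4 ≤ (P n).real (Prod.mk T ⁻¹' tooLarge P C M n ε κ)})) := by
        refine measure_mono fun T hT => ?_
        by_contra hcon
        simp only [mem_union, mem_ofPred_eq, not_or, not_lt, not_le, S, not_not] at hcon
        obtain ⟨⟨c1, c2⟩, c3, c4⟩ := hcon
        have hT' : η ≤ ⨆ α : Icc (0 : ℝ) 1, |missProb P M n α 0 T - (α : ℝ)| := hT
        have : ⨆ α : Icc (0 : ℝ) 1, |missProb P M n α 0 T - (α : ℝ)|
            ≤ 2 * κ + K * ε +
              (P n).real (Prod.mk T ⁻¹' tooSmall P C M n 0 ε κ) +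
              (P n).real (Prod.mk T ⁻¹' tooLarge P C M n ε κ) :=
          ciSup_le fun α => abs_missProb_sub_le hC c1 c2 hε hκ α.2
        linarith
    _ ≤ (0 + ξ / 2) + ξ / 2 := by
        refine (measure_union_le _ _).trans (add_le_add ?_ ?_)
        · refine (measure_union_le _ _).trans (add_le_add hS.le (hK n hn1))
        · exact (measure_union_le _ _).trans hn
    _ = ξ := by rw [zero_add, ENNReal.add_halves]

lemma Follows.conservativeAndValid (h : Follows P C M) (hC : ∀ n m : ℕ, Measurable
    (fun w : Obs (Y n) (p n) × (Fin m → Obs (Y n) (p n)) => C n m w.1 w.2)) :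
    ConservativeAndValid P C M :=
  ⟨h.inflatedConservative hC, h.nonInflatedValid hC⟩

end Follows

/-! ### Methods based on counting comparisons -/

section Counting

variable {Y : ℕ → Set ℝ} {p : ℕ → ℕ} {P : ∀ n, Measure (Obs (Y n) (p n))}
  [∀ n, IsProbabilityMeasure (P n)] {C : Score Y p} {M : Method Y p}

/-- The sandwich of the ramp between two indicators is integrated over the independent copy, with
the training data and the new score held fixed. -/
lemma copyMean_ramp_bounds (hC : IsConformityScore C) (n : ℕ)
    (w : (Fin (n + 1) → Obs (Y (n + 1)) (p (n + 1))) × Obs (Y (n + 1)) (p (n + 1))) (a : ℝ)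
    {ε : ℝ} (hε : 0 < ε) :
    survival P C (n + 1) w.1 (C (n + 1) (n + 1) w.2 w.1 + a + ε)
        ≤ copyMean (P (n + 1)) (C (n + 1)) (ramp a ε) n w ∧
      copyMean (P (n + 1)) (C (n + 1)) (ramp a ε) n w
        ≤ survival P C (n + 1) w.1 (C (n + 1) (n + 1) w.2 w.1 + a) := by
  have hm := measurable_score hC.measurable (n + 1) w.1
  have hψ := isUnitLipschitz_ramp a hε
  set c := C (n + 1) (n + 1) w.2 w.1 with hc
  have hint : Integrable (fun z => ramp a ε (C (n + 1) (n + 1) z w.1 - c)) (P (n + 1)) :=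
    integrable_of_abs_le_one (hψ.measurable.comp (hm.sub_const c)) fun _ => hψ.abs_le_one _
  have hset : ∀ r, MeasurableSet {z | r ≤ C (n + 1) (n + 1) z w.1} := fun r =>
    measurableSet_le measurable_const hm
  have hind : ∀ r, ∫ z, {z | r ≤ C (n + 1) (n + 1) z w.1}.indicator (fun _ => (1 : ℝ)) z ∂P (n + 1)
      = survival P C (n + 1) w.1 r := fun r => by
    rw [integral_indicator_const _ (hset r), smul_eq_mul, mul_one]; rfl
  have hindi : ∀ r, Integrable ({z | r ≤ C (n + 1) (n + 1) z w.1}.indicator (fun _ => (1 : ℝ)))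
      (P (n + 1)) := fun r => (integrable_const (1 : ℝ)).indicator (hset r)
  constructor
  · rw [← hind]
    refine integral_mono (hindi _) hint fun z => ?_
    refine le_trans (le_of_eq ?_) (indicator_le_ramp a hε _)
    simp only [indicator_apply, mem_ofPred_eq]
    have e : newScore (C (n + 1)) n (w.1, z) - newScore (C (n + 1)) n w
      = C (n + 1) (n + 1) z w.1 - c := rfl
    rw [e]
    refine if_congr ?_ rfl rfl
    constructor <;> intro h <;> linarith
  · rw [← hind]
    refine integral_mono hint (hindi _) fun z => ?_
    refine le_trans (ramp_le_indicator a hε _) (le_of_eq ?_)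
    simp only [indicator_apply, mem_ofPred_eq]
    have e : newScore (C (n + 1)) n (w.1, z) - newScore (C (n + 1)) n w
      = C (n + 1) (n + 1) z w.1 - c := rfl
    rw [e]
    refine if_congr ?_ rfl rfl
    constructor <;> intro h <;> linarith

lemma tendsto_average_sub_copyMean (hC : IsConformityScore C)
    (hτ : Tendsto (fun n => instability (P (n + 1)) (C (n + 1)) n) atTop (𝓝 0))
    {u : ∀ n, (Fin (n + 1) → Obs (Y (n + 1)) (p (n + 1))) × Obs (Y (n + 1)) (p (n + 1)) →
      Fin (n + 1) → ℝ} (hu : ∀ n i, Measurable fun w => u n w i) {r : ℕ → ℝ}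
    (hr0 : Tendsto r atTop (𝓝 0))
    (hr : ∀ n i, ∫ w, tdist (u n w i)
      (looScore (C (n + 1)) n w i - newScore (C (n + 1)) n w) ∂pairLaw (P (n + 1)) n ≤ r n)
    {ψ : ℝ → ℝ} {L : ℝ} (hψ : IsUnitLipschitz ψ L) {κ : ℝ} (hκ : 0 < κ) :
    Tendsto (fun n => jointLaw P (n + 1) {w | κ ≤ |(∑ i, ψ (u n w i)) / (n + 1 : ℝ)
      - copyMean (P (n + 1)) (C (n + 1)) ψ n w|}) atTop (𝓝 0) := by
  have hb : Tendsto (fun n : ℕ => ENNReal.ofReal (2 * L / κ * r n + 4 / κ ^ 2 *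
      (1 / (n + 1 : ℝ) + 20 * L * instability (P (n + 1)) (C (n + 1)) n))) atTop (𝓝 0) := by
    have h1 := (hr0.const_mul (2 * L / κ)).add
      ((tendsto_one_div_add_atTop_nhds_zero_nat.add (hτ.const_mul (20 * L))).const_mul (4 / κ ^ 2))
    simp only [mul_zero, add_zero] at h1
    have h2 := ENNReal.tendsto_ofReal h1
    rwa [ENNReal.ofReal_zero] at h2
  refine tendsto_of_tendsto_of_tendsto_of_le_of_le tendsto_const_nhds hb (fun _ => zero_le)
    fun n => ?_
  have := measureReal_average_sub_copyMean_le (P (n + 1)) (hC.measurable (n + 1))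
    (hC.symmetric (n + 1)) hψ n (hu n) (hr n) hκ
  rw [← ofReal_measureReal]
  exact ENNReal.ofReal_le_ofReal this

/-- A method follows a stable score if it is based on counting comparisons that are close to those
of the leave-one-out scores with the score of the new pair. -/
lemma follows_of_count (hC : IsConformityScore C)
    (hτ : Tendsto (fun n => instability (P (n + 1)) (C (n + 1)) n) atTop (𝓝 0))
    {u v : ∀ n, (Fin (n + 1) → Obs (Y (n + 1)) (p (n + 1))) × Obs (Y (n + 1)) (p (n + 1)) →
      Fin (n + 1) → ℝ} (hu : ∀ n i, Measurable fun w => u n w i)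
    (hv : ∀ n i, Measurable fun w => v n w i) {r : ℕ → ℝ} (hr0 : Tendsto r atTop (𝓝 0))
    (hur : ∀ n i, ∫ w, tdist (u n w i)
      (looScore (C (n + 1)) n w i - newScore (C (n + 1)) n w) ∂pairLaw (P (n + 1)) n ≤ r n)
    (hvr : ∀ n i, ∫ w, tdist (v n w i)
      (looScore (C (n + 1)) n w i - newScore (C (n + 1)) n w) ∂pairLaw (P (n + 1)) n ≤ r n)
    (hmiss : ∀ n α δ w, α ∈ Icc (0 : ℝ) 1 → 0 ≤ δ → w.2.1 ∉ M (n + 1) α δ w.1 w.2.2 →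
      (∑ i, if -δ ≤ u n w i then (1 : ℝ) else 0) ≤ α * (n + 1) + 1)
    (hcover : ∀ n α w, α ∈ Icc (0 : ℝ) 1 → w.2.1 ∈ M (n + 1) α 0 w.1 w.2.2 →
      α * (n + 1) ≤ (∑ i, if 0 ≤ v n w i then (1 : ℝ) else 0) + 1) :
    Follows P C M := by
  have hlarge : ∀ κ : ℝ, 0 < κ → ∀ᶠ n : ℕ in atTop, 1 / (n + 1 : ℝ) < κ := fun κ hκ =>
    tendsto_one_div_add_atTop_nhds_zero_nat.eventually (gt_mem_nhds hκ)
  constructor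
  · intro δ ε κ hδ hε hκ
    refine (tendsto_add_atTop_iff_nat 1).1 ?_
    refine tendsto_of_tendsto_of_tendsto_of_le_of_le' tendsto_const_nhds
      (tendsto_average_sub_copyMean hC hτ hu hr0 hur (isUnitLipschitz_ramp (-δ) hε)
        (half_pos hκ)) (Eventually.of_forall fun _ => zero_le) ?_
    filter_upwards [hlarge _ (half_pos hκ)] with n hn
    refine measure_mono ?_
    rintro w ⟨α, hα, hw, hlt⟩
    have hn0 : (0 : ℝ) < n + 1 := by positivity
    -- On this event `copyMean` exceeds `α + κ`, whereas the average of ramps is at most `α + 1 / (n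
    -- + 1)`. Hence they differ by at least `κ / 2`.
    have h1 := (copyMean_ramp_bounds (P := P) hC n w (-δ) hε).1
    have h2 := hmiss n α δ w hα hδ hw
    have h3 : (∑ i, ramp (-δ) ε (u n w i)) / (n + 1 : ℝ) ≤ α + 1 / (n + 1) := by
      rw [div_le_iff₀ hn0, add_mul, one_div, inv_mul_cancel₀ hn0.ne']
      exact (Finset.sum_le_sum fun i _ => ramp_le_indicator _ hε _).trans h2
    rw [← sub_eq_add_neg] at h1
    show κ / 2 ≤ |_|
    rw [abs_sub_comm]
    refine le_trans ?_ (le_abs_self _)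
    linarith
  · intro ε κ hε hκ
    refine (tendsto_add_atTop_iff_nat 1).1 ?_
    refine tendsto_of_tendsto_of_tendsto_of_le_of_le' tendsto_const_nhds
      (tendsto_average_sub_copyMean hC hτ hv hr0 hvr (isUnitLipschitz_ramp (-ε) hε)
        (half_pos hκ)) (Eventually.of_forall fun _ => zero_le) ?_
    filter_upwards [hlarge _ (half_pos hκ)] with n hn
    refine measure_mono ?_
    rintro w ⟨α, hα, hw, hlt⟩
    have hn0 : (0 : ℝ) < n + 1 := by positivity
    -- The ramp now starts at `-ε`, so that it dominates the indicator of `0 ≤ v` while its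
    -- `copyMean` is still bounded by the survival function at the score minus `ε`.
    have h1 := (copyMean_ramp_bounds (P := P) hC n w (-ε) hε).2
    have h2 := hcover n α w hα hw
    have h3 : α - 1 / (n + 1) ≤ (∑ i, ramp (-ε) ε (v n w i)) / (n + 1 : ℝ) := by
      rw [le_div_iff₀ hn0, sub_mul, one_div, inv_mul_cancel₀ hn0.ne', sub_le_iff_le_add]
      refine h2.trans (add_le_add (Finset.sum_le_sum fun i _ => ?_) le_rfl)
      have := indicator_le_ramp (-ε) hε (v n w i)
      rwa [neg_add_cancel] at this
    rw [← sub_eq_add_neg] at h1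
    show κ / 2 ≤ |_|
    refine le_trans ?_ (le_abs_self _)
    linarith

end Counting

/-! ### Stability -/

/-- Convergence to zero in probability implies convergence to zero of the mean truncated
distances. -/
lemma tendsto_integral_tdist {Ω : ℕ → Type*} [∀ n, MeasurableSpace (Ω n)]
    {μ : ∀ n, Measure (Ω n)} [∀ n, IsProbabilityMeasure (μ n)] {X X' : ∀ n, Ω n → ℝ}
    (hX : ∀ n, Measurable (X n)) (hX' : ∀ n, Measurable (X' n))
    (h : ∀ ε : ℝ, 0 < ε → Tendsto (fun n => μ n {ω | ε ≤ |X n ω - X' n ω|}) atTop (𝓝 0)) :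
    Tendsto (fun n => ∫ ω, tdist (X n ω) (X' n ω) ∂μ n) atTop (𝓝 0) := by
  have h1 := tendsto_lintegral_of_tendsto_measure (μ := μ)
    (X := fun n ω => tdist (X n ω) (X' n ω)) (fun n ω => tdist_le_one _ _) fun η hη =>
      tendsto_of_tendsto_of_tendsto_of_le_of_le tendsto_const_nhds (h η hη) (fun _ => zero_le)
        fun n => measure_mono fun ω (hω : η ≤ _) => hω.trans (tdist_le_abs _ _)
  have h2 : ∀ n, ∫ ω, tdist (X n ω) (X' n ω) ∂μ n
      = (∫⁻ ω, ENNReal.ofReal (tdist (X n ω) (X' n ω)) ∂μ n).toReal := fun n =>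
    integral_eq_lintegral_of_nonneg_ae (ae_of_all _ fun _ => tdist_nonneg _ _)
      (measurable_tdist (hX n) (hX' n)).aestronglyMeasurable
  simp only [h2]
  exact (ENNReal.tendsto_toReal ENNReal.zero_ne_top).comp h1

section Stability

variable {Y : ℕ → Set ℝ} {p : ℕ → ℕ} {P : ∀ n, Measure (Obs (Y n) (p n))}

lemma measurable_init {Z : Type*} [MeasurableSpace Z] {n : ℕ} :
    Measurable fun T : Fin (n + 1) → Z => (Fin.init T : Fin n → Z) :=
  measurable_pi_lambda _ fun _ => measurable_pi_apply _

lemma StableScore.tendsto_instability [∀ n, IsProbabilityMeasure (P n)] {C : Score Y p}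
    (h : StableScore P C) (hC : IsConformityScore C) :
    Tendsto (fun n => instability (P (n + 1)) (C (n + 1)) n) atTop (𝓝 0) :=
  tendsto_integral_tdist (μ := fun n => jointLaw P (n + 1))
    (fun n => measurable_score_comp (hC.measurable (n + 1)) measurable_snd measurable_fst)
    (fun n => measurable_score_comp (hC.measurable (n + 1)) measurable_snd
      (measurable_init.comp measurable_fst)) h

/-- The prediction of an algorithm as a score that ignores the response. -/
def predScore (A : Algorithm Y p) : Score Y p := fun n m z T => A n m z.2 T

lemma IsSymmetricAlgorithm.predScore {A : Algorithm Y p} (hA : IsSymmetricAlgorithm A) :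
    IsConformityScore (predScore A) where
  measurable n m := measurable_subtype_coe.comp ((hA.measurable n m).comp
    ((measurable_snd.comp measurable_fst).prodMk measurable_snd))
  symmetric n m z T π := congrArg Subtype.val (hA.symmetric n m z.2 T π)

lemma IsSymmetricAlgorithm.outScore {A : Algorithm Y p} (hA : IsSymmetricAlgorithm A) :
    IsConformityScore (outScore A) where
  measurable n m := by
    have h1 := hA.predScore.measurable n m
    have h2 : Measurable fun w : Obs (Y n) (p n) × (Fin m → Obs (Y n) (p n)) => (w.1.1 : ℝ) := by
      fun_prop
    exact (h2.sub h1).abs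
  symmetric n m z T π := by simp only [Conformal.outScore, hA.symmetric]

lemma StableAlgorithm.predScore {A : Algorithm Y p} (h : StableAlgorithm P A) :
    StableScore P (predScore A) := h

lemma StableAlgorithm.outScore {A : Algorithm Y p} (h : StableAlgorithm P A) :
    StableScore P (outScore A) := fun ε hε =>
  tendsto_of_tendsto_of_tendsto_of_le_of_le tendsto_const_nhds (h ε hε) (fun _ => zero_le)
    fun n => measure_mono fun w (hw : ε ≤ _) => by
      refine hw.trans ((abs_abs_sub_abs_le_abs_sub _ _).trans (le_of_eq ?_))
      rw [sub_sub_sub_cancel_left, abs_sub_comm]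

end Stability

/-! ### Quantiles -/

/-- Lower bounds on an infimum can be tested on its members, so the infinite quantiles are settled
here and the later counting takes place in `ℝ`. -/
lemma coe_le_quantile_add_iff (c δ β : ℝ) (F : ℝ → ℝ) :
    (c : EReal) ≤ quantile β F + (δ : EReal) ↔ ∀ u, β ≤ F u → c ≤ u + δ := by
  have h1 : (c : EReal) ≤ quantile β F + (δ : EReal) ↔ ((c - δ : ℝ) : EReal) ≤ quantile β F := by
    induction quantile β F with
    | bot => simp only [EReal.bot_add, le_bot_iff, EReal.coe_ne_bot]
    | top => simp
    | coe q => norm_cast; exact sub_le_iff_le_add.symm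
  rw [h1, quantile, le_sInf_iff, forall_mem_image]
  simp only [mem_ofPred_eq, EReal.coe_le_coe_iff, sub_le_iff_le_add]

lemma lt_of_quantile_sub_not_le {y δ β : ℝ} {F : ℝ → ℝ}
    (h : ¬ quantile β F - (δ : EReal) ≤ (y : EReal)) {u : ℝ} (hu : β ≤ F u) : y + δ < u := by
  have h1 : quantile β F ≤ (u : EReal) := sInf_le ⟨u, hu, rfl⟩
  have h2 : ((y + δ : ℝ) : EReal) < quantile β F := by
    revert h
    induction quantile β F with
    | bot => simp
    | top => simpa using EReal.coe_lt_top (y + δ)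
    | coe q => norm_cast; intro h; linarith [not_le.1 h]
  exact_mod_cast h2.trans_le h1

lemma exists_of_quantile_le {y β : ℝ} {F : ℝ → ℝ} (h : quantile β F ≤ (y : EReal)) {r : ℝ}
    (hr : y < r) : ∃ u, β ≤ F u ∧ u < r := by
  have : quantile β F < (r : EReal) := h.trans_lt (by exact_mod_cast hr)
  obtain ⟨_, ⟨u, hu, rfl⟩, hur⟩ := sInf_lt_iff.1 this
  exact ⟨u, hu, EReal.coe_lt_coe_iff.1 hur⟩

lemma le_coe_sub_of_not_lt_add {c δ : ℝ} {q : EReal} (h : ¬ (c : EReal) < q + (δ : EReal)) :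
    q ≤ ((c - δ : ℝ) : EReal) := by
  revert h
  induction q with
  | bot => simp
  | top => simp [EReal.coe_lt_top]
  | coe q => norm_cast; intro h; linarith [not_lt.1 h]

lemma sub_le_and_le_add_iff (a y : ℝ) (q : EReal) :
    ((a : EReal) - q ≤ (y : EReal) ∧ (y : EReal) ≤ (a : EReal) + q) ↔
      ((|y - a| : ℝ) : EReal) ≤ q := by
  induction q with
  | bot => simp
  | top => simp
  | coe q =>
    norm_cast
    rw [abs_le]
    constructor <;> rintro ⟨h1, h2⟩ <;> constructor <;> linarith

lemma sub_lt_and_lt_add_iff (a y : ℝ) (q : EReal) :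
    ((a : EReal) - q < (y : EReal) ∧ (y : EReal) < (a : EReal) + q) ↔
      ((|y - a| : ℝ) : EReal) < q := by
  induction q with
  | bot => simp
  | top => simp [EReal.bot_lt_coe, EReal.coe_lt_top]
  | coe q =>
    norm_cast
    rw [abs_lt]
    constructor <;> rintro ⟨h1, h2⟩ <;> constructor <;> linarith

/-! ### Counting -/

section Count

variable {N : ℕ}

lemma sum_ite_add_sum_ite_le {q r : Fin N → Prop} [DecidablePred q] [DecidablePred r]
    (h : ∀ i, q i → ¬ r i) :
    (∑ i, if q i then (1 : ℝ) else 0) + (∑ i, if r i then (1 : ℝ) else 0) ≤ N := by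
  rw [← Finset.sum_add_distrib]
  calc _ ≤ ∑ _i : Fin N, (1 : ℝ) := Finset.sum_le_sum fun i _ => by
        have := h i
        split_ifs <;> simp_all
    _ = N := by simp

lemma le_sum_ite_add_sum_ite {q r : Fin N → Prop} [DecidablePred q] [DecidablePred r]
    (h : ∀ i, ¬ r i → q i) :
    (N : ℝ) ≤ (∑ i, if q i then (1 : ℝ) else 0) + (∑ i, if r i then (1 : ℝ) else 0) := by
  rw [← Finset.sum_add_distrib]
  calc (N : ℝ) = ∑ _i : Fin N, (1 : ℝ) := by simp
    _ ≤ _ := Finset.sum_le_sum fun i _ => by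
        have := h i
        split_ifs <;> simp_all

lemma sum_ite_le_sum_ite {q r : Fin N → Prop} [DecidablePred q] [DecidablePred r]
    (h : ∀ i, q i → r i) :
    (∑ i, if q i then (1 : ℝ) else 0) ≤ ∑ i, if r i then (1 : ℝ) else 0 :=
  Finset.sum_le_sum fun i _ => by
    have := h i
    split_ifs <;> simp_all

/-- With finitely many values there is a gap just below `c`. Evaluating an empirical distribution
function there counts exactly the values that are strictly below `c`. -/
lemma exists_lt_forall_le (v : Fin N → ℝ) (c : ℝ) : ∃ u < c, ∀ i, v i < c → v i ≤ u := by
  have h : ∀ᶠ u in 𝓝[<] c, ∀ i, v i < c → v i ≤ u := eventually_all.2 fun i => by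
    by_cases hi : v i < c
    · filter_upwards [Ioo_mem_nhdsLT hi] with u hu _ using hu.1.le
    · exact Eventually.of_forall fun u h => absurd h hi
  obtain ⟨u, hu, hu'⟩ := (h.and self_mem_nhdsWithin).exists
  exact ⟨u, hu', hu⟩

lemma exists_gt_forall_le (v : Fin N → ℝ) (y : ℝ) : ∃ r > y, ∀ i, v i < r → v i ≤ y := by
  have h : ∀ᶠ r in 𝓝[>] y, ∀ i, v i < r → v i ≤ y := eventually_all.2 fun i => by
    by_cases hi : y < v i
    · filter_upwards [Ioo_mem_nhdsGT hi] with r hr h using absurd h (not_lt.2 hr.2.le)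
    · exact Eventually.of_forall fun u h => not_lt.1 hi
  obtain ⟨r, hr, hr'⟩ := (h.and self_mem_nhdsWithin).exists
  exact ⟨r, hr', hr⟩

/-- Some `u < c - δ` has at least a fraction `1 - α` of the values at or below it, and these are
disjoint from the values counted. -/
lemma sum_ite_le_of_not_le_quantile_add {v : Fin (N + 1) → ℝ} {c δ α : ℝ}
    (h : ¬ (c : EReal) ≤ quantile (1 - α) (ecdf v) + (δ : EReal)) :
    (∑ i, if c - δ ≤ v i then (1 : ℝ) else 0) ≤ α * (N + 1) := by
  rw [coe_le_quantile_add_iff] at h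
  push Not at h
  obtain ⟨u, hu, huc⟩ := h
  rw [ecdf, Nat.cast_succ, le_div_iff₀ (by positivity)] at hu
  have := sum_ite_add_sum_ite_le (q := fun i => c - δ ≤ v i) (r := fun i => v i ≤ u)
    fun i h1 h2 => by linarith
  push_cast at this
  linarith

/-- Just below `c` the empirical distribution function is still less than `1 - α`; the remaining
values are all at least `c`. -/
lemma lt_sum_ite_of_le_quantile_add {v : Fin (N + 1) → ℝ} {c α : ℝ}
    (h : (c : EReal) ≤ quantile (1 - α) (ecdf v) + ((0 : ℝ) : EReal)) :
    α * (N + 1) < ∑ i, if c ≤ v i then (1 : ℝ) else 0 := by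
  rw [coe_le_quantile_add_iff] at h
  obtain ⟨u, huc, hu⟩ := exists_lt_forall_le v c
  have h1 : ecdf v u < 1 - α := by
    by_contra hcon
    have := h u (not_lt.1 hcon)
    linarith
  rw [ecdf, Nat.cast_succ, div_lt_iff₀ (by positivity)] at h1
  have := le_sum_ite_add_sum_ite (q := fun i => c ≤ v i) (r := fun i => v i ≤ u)
    fun i h2 => not_lt.1 fun h3 => h2 (hu i h3)
  push_cast at this
  linarith

end Count

/-! ### The conformal methods -/

section Methods

variable {Y : ℕ → Set ℝ} {p : ℕ → ℕ} {P : ∀ n, Measure (Obs (Y n) (p n))}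
  [∀ n, IsProbabilityMeasure (P n)] {C : Score Y p}

lemma tdist_self (a : ℝ) : tdist a a = 0 := by simp [tdist]

theorem follows_shortcut (hC : IsConformityScore C) (h : StableScore P C) :
    Follows P C (shortcut C) := by
  have hm : ∀ n i, Measurable fun w => looScore (C (n + 1)) n w i - newScore (C (n + 1)) n w :=
    fun n i => (measurable_looScore (hC.measurable (n + 1)) n i).sub
      (measurable_newScore (hC.measurable (n + 1)) n)
  refine follows_of_count hC (h.tendsto_instability hC) hm hm (r := fun _ => 0)
    tendsto_const_nhds (fun n i => by simp [tdist_self]) (fun n i => by simp [tdist_self])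
    (fun n α δ w hα hδ hw => ?_) (fun n α w hα hw => ?_)
  · have h1 := sum_ite_le_of_not_le_quantile_add (N := n) hw
    refine (sum_ite_le_sum_ite fun i hi => ?_).trans (h1.trans (by linarith))
    have : -δ ≤ C (n + 1) n (w.1 i) (del w.1 i) - C (n + 1) (n + 1) w.2 w.1 := hi
    show C (n + 1) (n + 1) w.2 w.1 - δ ≤ C (n + 1) n (w.1 i) (del w.1 i)
    linarith
  · have h1 := lt_sum_ite_of_le_quantile_add (N := n) hw
    refine (h1.le.trans (sum_ite_le_sum_ite fun i hi => ?_)).trans (by linarith)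
    exact sub_nonneg.2 hi

/-- The comparisons use the score of the new pair with one training point deleted. They differ from
the exact ones by a single deletion, which stability controls. -/
theorem follows_crossConformal (hC : IsConformityScore C) (h : StableScore P C) :
    Follows P C (crossConformal C) := by
  have hCm := fun n => hC.measurable (n + 1)
  set u : ∀ n, (Fin (n + 1) → Obs (Y (n + 1)) (p (n + 1))) × Obs (Y (n + 1)) (p (n + 1)) →
      Fin (n + 1) → ℝ := fun n w i =>
    looScore (C (n + 1)) n w i - C (n + 1) n w.2 (i.removeNth w.1) with hu
  have hm1 : ∀ n (i : Fin (n + 1)), Measurable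
      fun w : (Fin (n + 1) → Obs (Y (n + 1)) (p (n + 1))) × Obs (Y (n + 1)) (p (n + 1)) =>
        C (n + 1) n w.2 (i.removeNth w.1) := fun n i =>
    measurable_score_comp (hCm n) measurable_snd ((measurable_removeNth i).comp measurable_fst)
  have hm : ∀ n i, Measurable fun w => u n w i :=
    fun n i => (measurable_looScore (hCm n) n i).sub (hm1 n i)
  have hr : ∀ n i, ∫ w, tdist (u n w i) (looScore (C (n + 1)) n w i - newScore (C (n + 1)) n w)
      ∂pairLaw (P (n + 1)) n ≤ instability (P (n + 1)) (C (n + 1)) n := fun n i => by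
    refine le_trans ?_ (integral_tdist_new_removeNth (P (n + 1)) (hCm n)
      (hC.symmetric (n + 1)) n i)
    refine integral_mono (integrable_tdist (hm n i) ((measurable_looScore (hCm n) n i).sub
      (measurable_newScore (hCm n) n))) (integrable_tdist (measurable_newScore (hCm n) n)
        (hm1 n i)) fun w => tdist_mono (le_of_eq ?_)
    simp only [hu, newScore]
    congr 1
    ring
  refine follows_of_count hC (h.tendsto_instability hC) hm hm (h.tendsto_instability hC) hr hr
    (fun n α δ w hα hδ hw => ?_) (fun n α w hα hw => ?_)
  · have h1 : 1 + (∑ i : Fin (n + 1), if C (n + 1) n w.2 (i.removeNth w.1) ≤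
        C (n + 1) n (w.1 i) (i.removeNth w.1) + δ then (1 : ℝ) else 0)
        ≤ α * ((n + 1 : ℕ) + 1) := not_lt.1 hw
    have h2 : (∑ i, if -δ ≤ u n w i then (1 : ℝ) else 0) ≤
        ∑ i : Fin (n + 1), if C (n + 1) n w.2 (i.removeNth w.1) ≤
          C (n + 1) n (w.1 i) (i.removeNth w.1) + δ then (1 : ℝ) else 0 :=
      sum_ite_le_sum_ite fun i hi => by simp only [hu, looScore] at hi; linarith
    push_cast at h1
    linarith [hα.2]
  · have h1 : α * ((n + 1 : ℕ) + 1) < 1 + (∑ i : Fin (n + 1),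
        if C (n + 1) n w.2 (i.removeNth w.1) ≤
        C (n + 1) n (w.1 i) (i.removeNth w.1) + 0 then (1 : ℝ) else 0) := hw
    have h2 : (∑ i : Fin (n + 1), if C (n + 1) n w.2 (i.removeNth w.1) ≤
          C (n + 1) n (w.1 i) (i.removeNth w.1) + 0 then (1 : ℝ) else 0) ≤
        ∑ i, if 0 ≤ u n w i then (1 : ℝ) else 0 :=
      sum_ite_le_sum_ite fun i hi => by simp only [hu, looScore]; linarith
    push_cast at h1
    linarith [hα.1]

/-- The scores in the augmented sample differ from the leave-one-out scores only by the presence of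
the new pair in the data. By exchangeability this costs one instability. -/
theorem follows_fullConformal (hC : IsConformityScore C) (h : StableScore P C) :
    Follows P C (fullConformal C) := by
  have hCm := fun n => hC.measurable (n + 1)
  set u : ∀ n, (Fin (n + 1) → Obs (Y (n + 1)) (p (n + 1))) × Obs (Y (n + 1)) (p (n + 1)) →
      Fin (n + 1) → ℝ := fun n w i =>
    augmentedScore (C (n + 1)) n w i - newScore (C (n + 1)) n w with hu
  have hm : ∀ n i, Measurable fun w => u n w i := fun n i =>
    (measurable_augmentedScore (hCm n) n i).sub (measurable_newScore (hCm n) n)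
  have hr : ∀ n i, ∫ w, tdist (u n w i) (looScore (C (n + 1)) n w i - newScore (C (n + 1)) n w)
      ∂pairLaw (P (n + 1)) n ≤ instability (P (n + 1)) (C (n + 1)) n := fun n i => by
    refine le_trans (le_of_eq (integral_congr_ae (ae_of_all _ fun w => ?_)))
      (integral_tdist_augmentedScore (P (n + 1)) (hCm n) (hC.symmetric (n + 1)) n i)
    simp only [hu, tdist, sub_sub_sub_cancel_right]
  have haug : ∀ n w t, augmentedCdf C (n + 1) w.1 w.2 t =
      ((if newScore (C (n + 1)) n w ≤ t then (1 : ℝ) else 0) +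
        ∑ i, if augmentedScore (C (n + 1)) n w i ≤ t then (1 : ℝ) else 0) / (n + 2) := by
    intro n w t
    rw [augmentedCdf, add_div, div_eq_inv_mul (∑ i, _), one_div]
    have : ((n + 1 : ℕ) : ℝ) + 1 = n + 2 := by push_cast; ring
    rw [this]
    rfl
  refine follows_of_count hC (h.tendsto_instability hC) hm hm (h.tendsto_instability hC) hr hr
    (fun n α δ w hα hδ hw => ?_) (fun n α w hα hw => ?_)
  · have h1 : ¬ ((newScore (C (n + 1)) n w : ℝ) : EReal) ≤
      quantile (1 - α) (augmentedCdf C (n + 1) w.1 w.2) + (δ : EReal) := hw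
    rw [coe_le_quantile_add_iff] at h1
    push Not at h1
    obtain ⟨t, ht, htc⟩ := h1
    -- Since `δ ≥ 0`, the level `t` lies below the new score, so the new pair does not contribute to
    -- the distribution function at `t`.
    rw [haug, le_div_iff₀ (by positivity), if_neg (by linarith)] at ht
    have := sum_ite_add_sum_ite_le (q := fun i => -δ ≤ u n w i)
      (r := fun i => augmentedScore (C (n + 1)) n w i ≤ t)
      fun i h1 h2 => by simp only [hu] at h1; linarith
    push_cast at this
    linarith [hα.2]
  · have h1 : ((newScore (C (n + 1)) n w : ℝ) : EReal) ≤
      quantile (1 - α) (augmentedCdf C (n + 1) w.1 w.2) + ((0 : ℝ) : EReal) := hw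
    rw [coe_le_quantile_add_iff] at h1
    obtain ⟨t, htc, ht⟩ := exists_lt_forall_le (augmentedScore (C (n + 1)) n w)
      (newScore (C (n + 1)) n w)
    have h2 : augmentedCdf C (n + 1) w.1 w.2 t < 1 - α := by
      by_contra hcon
      have := h1 t (not_lt.1 hcon)
      linarith
    rw [haug, div_lt_iff₀ (by positivity), if_neg (by linarith)] at h2
    have := le_sum_ite_add_sum_ite (q := fun i => 0 ≤ u n w i)
      (r := fun i => augmentedScore (C (n + 1)) n w i ≤ t)
      fun i h3 => sub_nonneg.2 (not_lt.1 fun h4 => h3 (ht i h4))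
    push_cast at this
    linarith [hα.1]

/-! ### The Jackknife methods and the oracle -/

variable {A : Algorithm Y p}

theorem jackknife_eq_shortcut (A : Algorithm Y p) :
    jackknife A = shortcut (outScore A) := by
  funext n α δ T x
  ext y
  exact sub_le_and_le_add_iff _ _ _

/-- Write `a` for the full prediction, `b i` for the leave-one-out predictions and `R i` for the
absolute residuals. A miss at either end bounds the number of `i` with `|y - b i| ≤ R i + δ`.
Covering only gives one-sided inequalities between `y` and `b i ± R i`, hence the extra slack `|a -
b i|` in the second count. Both counts are within `2 * |a - b i|` of the exact comparisons, which
stability of the predictions makes small. -/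
theorem follows_jackknifePlus (hA : IsSymmetricAlgorithm A) (h : StableAlgorithm P A) :
    Follows P (outScore A) (jackknifePlus A) := by
  have hC := hA.outScore
  have hCm := fun n => hC.measurable (n + 1)
  have hPm := fun n => hA.predScore.measurable (n + 1)
  have hτ := (h.predScore.tendsto_instability hA.predScore).const_mul 2
  rw [mul_zero] at hτ
  let Ω : ℕ → Type := fun n =>
    (Fin (n + 1) → Obs (Y (n + 1)) (p (n + 1))) × Obs (Y (n + 1)) (p (n + 1))
  let a : ∀ n, Ω n → ℝ := fun n w => A (n + 1) (n + 1) w.2.2 w.1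
  let b : ∀ n, Ω n → Fin (n + 1) → ℝ := fun n w i => A (n + 1) n w.2.2 (i.removeNth w.1)
  let R : ∀ n, Ω n → Fin (n + 1) → ℝ := fun n w i => looScore (outScore A (n + 1)) n w i
  let y : ∀ n, Ω n → ℝ := fun n w => w.2.1
  have hR0 : ∀ n w i, 0 ≤ R n w i := fun n w i => abs_nonneg _
  have ham : ∀ n, Measurable (a n) := fun n => measurable_newScore (hPm n) n
  have hbm : ∀ n i, Measurable fun w => b n w i := fun n i =>
    measurable_score_comp (hPm n) measurable_snd ((measurable_removeNth i).comp measurable_fst)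
  have hRm : ∀ n i, Measurable fun w => R n w i := fun n i => measurable_looScore (hCm n) n i
  have hym : ∀ n, Measurable (y n) := fun n =>
    measurable_subtype_coe.comp (measurable_fst.comp measurable_snd)
  have hclose : ∀ (u : ∀ n, Ω n → Fin (n + 1) → ℝ), (∀ n i, Measurable fun w => u n w i) →
      (∀ n w i, |u n w i - (R n w i - |y n w - a n w|)| ≤ |a n w - b n w i| + |a n w - b n w i|) →
      ∀ n i, ∫ w, tdist (u n w i) (looScore (outScore A (n + 1)) n w i -
        newScore (outScore A (n + 1)) n w) ∂pairLaw (P (n + 1)) n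
        ≤ 2 * instability (P (n + 1)) (predScore A (n + 1)) n := fun u hum hu n i => by
    refine le_trans ?_ (mul_le_mul_of_nonneg_left (integral_tdist_new_removeNth (P (n + 1)) (hPm n)
      (hA.predScore.symmetric (n + 1)) n i) zero_le_two)
    rw [← integral_const_mul]
    refine integral_mono (integrable_tdist (hum n i) ((measurable_looScore (hCm n) n i).sub
      (measurable_newScore (hCm n) n))) ((integrable_tdist (ham n) (hbm n i)).const_mul 2)
        fun w => ?_
    refine (tdist_le_of_abs_le_add (hu n w i)).trans (le_of_eq (two_mul _).symm)
  have hmu : ∀ n i, Measurable fun w : Ω n => R n w i - |y n w - b n w i| := fun n i =>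
    (hRm n i).sub ((hym n).sub (hbm n i)).abs
  have hmv : ∀ n i, Measurable fun w : Ω n =>
      R n w i - |y n w - b n w i| + |a n w - b n w i| := fun n i =>
    (hmu n i).add ((ham n).sub (hbm n i)).abs
  refine follows_of_count hC (h.outScore.tendsto_instability hC) hmu hmv hτ
    (hclose _ hmu fun n w i => ?_) (hclose _ hmv fun n w i => ?_)
    (fun n α δ w hα hδ hw => ?_) (fun n α w hα hw => ?_)
  · have h1 := abs_sub_abs_le_abs_sub (y n w - a n w) (y n w - b n w i)
    have h2 := abs_sub_abs_le_abs_sub (y n w - b n w i) (y n w - a n w)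
    rw [sub_sub_sub_cancel_left] at h1 h2
    rw [abs_sub_comm (b n w i)] at h1
    have h3 := abs_nonneg (a n w - b n w i)
    rw [abs_le]
    constructor <;> linarith
  · have h1 := abs_sub_abs_le_abs_sub (y n w - a n w) (y n w - b n w i)
    have h2 := abs_sub_abs_le_abs_sub (y n w - b n w i) (y n w - a n w)
    rw [sub_sub_sub_cancel_left] at h1 h2
    rw [abs_sub_comm (b n w i)] at h1
    have h3 := abs_nonneg (a n w - b n w i)
    rw [abs_le]
    constructor <;> linarith
  · have hw' : ¬ (quantile α (ecdf fun i => b n w i - R n w i) - (δ : EReal) ≤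
        ((y n w : ℝ) : EReal) ∧ ((y n w : ℝ) : EReal) ≤
        quantile (1 - α) (ecdf fun i => b n w i + R n w i) + (δ : EReal)) := hw
    rw [not_and_or] at hw'
    rcases hw' with h1 | h1
    · have h2 : ecdf (fun i => b n w i - R n w i) (y n w + δ) < α := by
        by_contra hcon
        exact lt_irrefl _ (lt_of_quantile_sub_not_le h1 (not_lt.1 hcon))
      rw [ecdf, Nat.cast_succ, div_lt_iff₀ (by positivity)] at h2
      refine (sum_ite_le_sum_ite fun i hi => ?_).trans (h2.le.trans (by linarith))
      have := neg_abs_le (y n w - b n w i)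
      have := le_abs_self (y n w - b n w i)
      linarith
    · have h2 := sum_ite_le_of_not_le_quantile_add (N := n) h1
      refine (sum_ite_le_sum_ite fun i hi => ?_).trans (h2.trans (by linarith))
      have := le_abs_self (y n w - b n w i)
      linarith
  · have hw' : quantile α (ecdf fun i => b n w i - R n w i) - ((0 : ℝ) : EReal) ≤
        ((y n w : ℝ) : EReal) ∧ ((y n w : ℝ) : EReal) ≤
        quantile (1 - α) (ecdf fun i => b n w i + R n w i) + ((0 : ℝ) : EReal) := hw
    obtain ⟨h1, h2⟩ := hw'
    rw [EReal.coe_zero, sub_zero] at h1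
    -- Only the endpoint on the side of `y` away from `a` is used. If `y` lies between `a` and `b
    -- i`, then `|y - b i| ≤ |a - b i|` and the slack alone suffices.
    rcases le_total (a n w) (y n w) with hy | hy
    · have h3 := lt_sum_ite_of_le_quantile_add (N := n) h2
      refine (h3.le.trans (sum_ite_le_sum_ite fun i hi => ?_)).trans (by linarith)
      have := hR0 n w i
      rcases abs_cases (y n w - b n w i) with ⟨e, _⟩ | ⟨e, _⟩ <;>
      rcases abs_cases (a n w - b n w i) with ⟨e', _⟩ | ⟨e', _⟩ <;> rw [e, e'] <;> linarith
    · obtain ⟨r, hr, hr'⟩ := exists_gt_forall_le (fun i => b n w i - R n w i) (y n w)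
      obtain ⟨u, hu, hur⟩ := exists_of_quantile_le h1 hr
      rw [ecdf, Nat.cast_succ, le_div_iff₀ (by positivity)] at hu
      refine (hu.trans (sum_ite_le_sum_ite fun i hi => ?_)).trans (by linarith)
      have := hR0 n w i
      have := hr' i (hi.trans_lt hur)
      rcases abs_cases (y n w - b n w i) with ⟨e, _⟩ | ⟨e, _⟩ <;>
      rcases abs_cases (a n w - b n w i) with ⟨e', _⟩ | ⟨e', _⟩ <;> rw [e, e'] <;> linarith

/-- Both exceptional events are empty for every `n`: the quantile is that of the true conditional
distribution, so a miss or a cover bounds the survival function directly, with `ε` making up for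
weak versus strict inequalities. -/
theorem follows_oracle (hA : IsSymmetricAlgorithm A) : Follows P (outScore A) (oracle P A) := by
  have hset : ∀ n (T : Fin n → Obs (Y n) (p n)) r, MeasurableSet {z | outScore A n n z T ≤ r} :=
    fun n T r => measurableSet_le (measurable_score hA.outScore.measurable n T) measurable_const
  have hcompl : ∀ n (T : Fin n → Obs (Y n) (p n)) r,
      (P n).real {z | r < outScore A n n z T} = 1 - (P n).real {z | outScore A n n z T ≤ r} :=
    fun n T r => by
      rw [← probReal_compl_eq_one_sub (hset n T r)]
      congr 1
      ext z
      exact (not_le (a := outScore A n n z T) (b := r)).symm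
  have hmem : ∀ n α δ (w : (Fin n → Obs (Y n) (p n)) × Obs (Y n) (p n)),
      w.2.1 ∈ oracle P A n α δ w.1 w.2.2 ↔ ((outScore A n n w.2 w.1 : ℝ) : EReal) <
        quantile (1 - α) (fun s => (P n).real {z | outScore A n n z w.1 ≤ s}) + (δ : EReal) :=
    fun n α δ w => sub_lt_and_lt_add_iff _ _ _
  constructor
  · intro δ ε κ hδ hε hκ
    refine tendsto_const_nhds.congr fun n => ?_
    rw [eq_comm, show tooSmall P (outScore A) (oracle P A) n δ ε κ = ∅ from ?_, measure_empty]
    refine eq_empty_of_forall_notMem ?_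
    rintro w ⟨α, hα, hw, hlt⟩
    rw [hmem] at hw
    obtain ⟨u, hu, huc⟩ := exists_of_quantile_le (le_coe_sub_of_not_lt_add hw)
      (lt_add_of_pos_right (outScore A n n w.2 w.1 - δ) hε)
    have h1 : survival P (outScore A) n w.1 (outScore A n n w.2 w.1 - δ + ε) ≤
        (P n).real {z | u < outScore A n n z w.1} := measureReal_mono fun z hz => huc.trans_le hz
    rw [hcompl] at h1
    linarith
  · intro ε κ hε hκ
    refine tendsto_const_nhds.congr fun n => ?_
    rw [eq_comm, show tooLarge P (outScore A) (oracle P A) n ε κ = ∅ from ?_, measure_empty]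
    refine eq_empty_of_forall_notMem ?_
    rintro w ⟨α, hα, hw, hlt⟩
    rw [hmem, EReal.coe_zero, add_zero] at hw
    have h1 : (P n).real {z | outScore A n n z w.1 ≤ outScore A n n w.2 w.1} < 1 - α := by
      by_contra hcon
      exact absurd hw (not_lt.2 (sInf_le ⟨_, not_lt.1 hcon, rfl⟩))
    have h2 : (P n).real {z | outScore A n n w.2 w.1 < outScore A n n z w.1} ≤
        survival P (outScore A) n w.1 (outScore A n n w.2 w.1 - ε) :=
      measureReal_mono fun z (hz : _ < _) =>
        show _ ≤ _ from (sub_le_self _ hε.le).trans hz.le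
    rw [hcompl] at h2
    linarith

end Methods

/-- Methods that are both conservative and valid are asymptotically equivalent. By the results above,
stability alone makes each of the methods conservative and valid, because its prediction sets follow
the conditional distribution of the score of the new pair. -/
lemma ConservativeAndValid.asympEquiv {Y : ℕ → Set ℝ} {p : ℕ → ℕ}
    {P : ∀ n, Measure (Obs (Y n) (p n))} {C : Score Y p} {M₁ M₂ : Method Y p}
    (h₁ : ConservativeAndValid P C M₁) (h₂ : ConservativeAndValid P C M₂) :
    AsympEquiv P C M₁ M₂ :=
  ⟨iff_of_true h₁.1 h₂.1, fun hcc => iff_of_true (h₁.2 hcc) (h₂.2 hcc)⟩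

end Conformal

end

/-! ### The main theorem -/

theorem mainTheorem9 (p : ℕ → ℕ) (Y : ℕ → Set ℝ) (hY : ∀ n, (Y n).OrdConnected)
    (P : ∀ n, Measure (Conformal.Obs (Y n) (p n))) [∀ n, IsProbabilityMeasure (P n)] :
    -- general stable scores
    (∀ C : Conformal.Score Y p, Conformal.IsConformityScore C → Conformal.StableScore P C →
      Conformal.AsympEquiv P C (Conformal.fullConformal C) (Conformal.shortcut C) ∧
      Conformal.AsympEquiv P C (Conformal.shortcut C) (Conformal.crossConformal C) ∧
      Conformal.AsympEquiv P C (Conformal.fullConformal C) (Conformal.crossConformal C)) ∧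
    (∀ A : Conformal.Algorithm Y p, Conformal.IsSymmetricAlgorithm A →
      -- the two Jackknife methods
      (Conformal.StableAlgorithm P A →
        Conformal.AsympEquiv P (Conformal.outScore A)
          (Conformal.jackknife A) (Conformal.jackknifePlus A)) ∧
      -- the Jackknife is the shortcut set for the out-of-sample score
      (∀ (n : ℕ) (α δ : ℝ) (T : Fin n → Conformal.Obs (Y n) (p n))
        (x : EuclideanSpace ℝ (Fin (p n))),
        Conformal.jackknife A n α δ T x =
          Conformal.shortcut (Conformal.outScore A) n α δ T x) ∧
      -- all four methods are equivalent
      (Conformal.StableAlgorithm P A →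
        Conformal.AsympEquiv P (Conformal.outScore A)
          (Conformal.fullConformal (Conformal.outScore A))
          (Conformal.crossConformal (Conformal.outScore A)) ∧
        Conformal.AsympEquiv P (Conformal.outScore A)
          (Conformal.crossConformal (Conformal.outScore A)) (Conformal.jackknife A) ∧
        Conformal.AsympEquiv P (Conformal.outScore A)
          (Conformal.jackknife A) (Conformal.jackknifePlus A)) ∧
      -- all four methods are conservative / valid, and equivalent to the oracle
      (Conformal.StableAlgorithm P A → Conformal.BoundedPredictionError P A →
        (∀ M ∈ ({Conformal.fullConformal (Conformal.outScore A),
            Conformal.crossConformal (Conformal.outScore A),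
            Conformal.jackknife A, Conformal.jackknifePlus A} : Set (Conformal.Method Y p)),
          Conformal.ConservativeAndValid P (Conformal.outScore A) M ∧
          Conformal.AsympEquiv P (Conformal.outScore A) M (Conformal.oracle P A)))) := by
  have hgen : ∀ C : Conformal.Score Y p, Conformal.IsConformityScore C →
      Conformal.StableScore P C →
      Conformal.ConservativeAndValid P C (Conformal.fullConformal C) ∧
      Conformal.ConservativeAndValid P C (Conformal.shortcut C) ∧
      Conformal.ConservativeAndValid P C (Conformal.crossConformal C) := fun C hC h =>
    ⟨(Conformal.follows_fullConformal hC h).conservativeAndValid hC.measurable,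
      (Conformal.follows_shortcut hC h).conservativeAndValid hC.measurable,
      (Conformal.follows_crossConformal hC h).conservativeAndValid hC.measurable⟩
  refine ⟨fun C hC h => ?_, fun A hA => ?_⟩
  · obtain ⟨h1, h2, h3⟩ := hgen C hC h
    exact ⟨h1.asympEquiv h2, h2.asympEquiv h3, h1.asympEquiv h3⟩
  have hor := (Conformal.follows_oracle (P := P) hA).conservativeAndValid hA.outScore.measurable
  have hall : Conformal.StableAlgorithm P A → _ := fun h => hgen _ hA.outScore h.outScore
  have hplus : Conformal.StableAlgorithm P A → _ := fun h =>
    (Conformal.follows_jackknifePlus hA h).conservativeAndValid hA.outScore.measurable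
  rw [Conformal.jackknife_eq_shortcut]
  refine ⟨fun h => (hall h).2.1.asympEquiv (hplus h), fun _ _ _ _ _ => rfl, fun h => ?_,
    fun h _ M hM => ?_⟩
  · obtain ⟨h1, h2, h3⟩ := hall h
    exact ⟨h1.asympEquiv h3, h3.asympEquiv h2, h2.asympEquiv (hplus h)⟩
  · obtain ⟨h1, h2, h3⟩ := hall h
    have hM' : Conformal.ConservativeAndValid P (Conformal.outScore A) M := by
      rcases hM with rfl | rfl | rfl | rfl
      exacts [h1, h3, h2, hplus h]
    exact ⟨hM', hM'.asympEquiv hor⟩
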